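/- Let $n\ge 0$. A vacillating tableau of empty shape and length $2n$ is a sequence $(\lambda^0,\dots,\lambda^{2n})$ of integer partitions with $\lambda^0=\lambda^{2n}=\emptyset$ such that, for $0\le i<n$, $\lambda^{2i+1}$ is $\lambda^{2i}$ or $\lambda^{2i}$ with one square deleted, and $\lambda^{2i+2}$ is $\lambda^{2i+1}$ or $\lambda^{2i+1}$ with one square added. Let $\mathcal{VT}_n$ be the set of these, let $\Pi_n$ be the set of set partitions of $\{1,\dots,n\}$, and let $\tau_n:\mathcal{VT}_n\to\mathcal{VT}_n$ be the map that conjugates every $\lambda^i$. The Chen--Deng--Du--Stanley--Yan map $\varphi_n:\Pi_n\to\mathcal{VT}_n$ sends $\pi$ to the sequence of shapes of the tableaux $T_0,\dots,T_{2n}$ obtained as follows. The arcs of $\pi$ are the pairs $(i,j)$, $i<j$, of consecutive elements of a block. Start with $T_{2n}=\emptyset$. For $j=n,n-1,\dots,1$: $T_{2j-1}$ is $T_{2j}$ with the entry $j$ removed if $j$ is the left endpoint of an arc, and $T_{2j}$ otherwise; $T_{2j-2}$ is obtained from $T_{2j-1}$ by RSK row insertion of $i$ if there is an arc $(i,j)$,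 and is $T_{2j-1}$ otherwise. Define the odd Fibonacci numbers $F_{2n-1}:=a_n$ by $a_0=a_1=1$ and $a_n=3a_{n-1}-a_{n-2}$ for $n\ge2$; for $n\ge1$ this is the usual Fibonacci number with index $2n-1$. Then: 1. $\varphi_n$ is a well-defined bijection, and the involution $\varphi_n^{-1}\circ\tau_n\circ\varphi_n$ of $\Pi_n$ has exactly $F_{2n-1}$ fixed points. 2. The fixed points of $\tau_n$ are exactly the $(\lambda^0,\dots,\lambda^{2n})\in\mathcal{VT}_n$ in which every $\lambda^i$ is $\emptyset$ or $(1)$. 3. These are in bijection with the Motzkin paths of length $n$ and height at most $1$ in which every level step at height $1$ carries a label $0$ or $1$. A bijection is given by letting the height at abscissa $i$ be $0$ if $\lambda^{2i}=\emptyset$ and $1$ if $\lambda^{2i}=(1)$, and by giving a level step at height $1$ from $i-1$ to $i$ the label $0$ if $\lambda^{2i-1}=(1)$ and $1$ if $\lambda^{2i-1}=\emptyset$. -/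

import Mathlib

/-! ### Set partitions and vacillating tableaux -/

/-- Set partitions of `[n] = {1, …, n}`. -/
abbrev SetPartition (n : ℕ) : Type := Finpartition (Finset.Icc 1 n)

/-- `μ` is obtained from `l` by adding one square
(equivalently, `l` is obtained from `μ` by deleting one square). -/
def AddsSquare (l μ : YoungDiagram) : Prop :=
  ∃ c, c ∉ l.cells ∧ μ.cells = insert c l.cells

/-- Vacillating tableaux of shape `l` and length `2 n`: sequences
`∅ = λ⁰, λ¹, …, λ²ⁿ = l` of integer partitions (as Young diagrams) such that `λ²ⁱ⁺¹` is `λ²ⁱ` or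
`λ²ⁱ` with one square deleted, and `λ²ⁱ⁺²` is `λ²ⁱ⁺¹` or `λ²ⁱ⁺¹` with one square added. -/
@[ext]
structure VacillatingTableau (n : ℕ) (l : YoungDiagram) where
  shape : Fin (2 * n + 1) → YoungDiagram
  shape_zero : shape 0 = ⊥
  shape_last : shape (Fin.last (2 * n)) = l
  odd_step : ∀ i : Fin n,
    shape ⟨2 * i + 1, by omega⟩ = shape ⟨2 * i, by omega⟩ ∨
      AddsSquare (shape ⟨2 * i + 1, by omega⟩) (shape ⟨2 * i, by omega⟩)
  even_step : ∀ i : Fin n,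
    shape ⟨2 * i + 2, by omega⟩ = shape ⟨2 * i + 1, by omega⟩ ∨
      AddsSquare (shape ⟨2 * i + 1, by omega⟩) (shape ⟨2 * i + 2, by omega⟩)

theorem AddsSquare.transpose {l μ : YoungDiagram} (h : AddsSquare l μ) :
    AddsSquare l.transpose μ.transpose := by
  obtain ⟨c, hc, h⟩ := h
  refine ⟨c.swap, ?_, ?_⟩
  · rw [YoungDiagram.mem_cells, YoungDiagram.mem_transpose, Prod.swap_swap]
    simpa using hc
  · ext x
    have hx : x.swap ∈ μ.cells ↔ x.swap = c ∨ x.swap ∈ l.cells := by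
      rw [h, Finset.mem_insert]
    have hs : x.swap = c ↔ x = c.swap := Prod.swap_eq_iff_eq_swap
    simp only [YoungDiagram.mem_cells, YoungDiagram.mem_transpose, Finset.mem_insert] at hx ⊢
    rw [hx, hs]

theorem YoungDiagram.transpose_bot' : (⊥ : YoungDiagram).transpose = ⊥ := by
  ext x
  simp

/-- The map `τ` on vacillating tableaux of empty shape which conjugates every partition in the
sequence. -/
def conjugateTableau {n : ℕ} (V : VacillatingTableau n ⊥) : VacillatingTableau n ⊥ where
  shape i := (V.shape i).transpose
  shape_zero := by rw [V.shape_zero, YoungDiagram.transpose_bot']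
  shape_last := by rw [V.shape_last, YoungDiagram.transpose_bot']
  odd_step i := (V.odd_step i).imp (fun h => by rw [h]) AddsSquare.transpose
  even_step i := (V.even_step i).imp (fun h => by rw [h]) AddsSquare.transpose

/-! ### The Chen–Deng–Du–Stanley–Yan map from set partitions to vacillating tableaux

Tableaux are lists of rows, rows are lists of entries. The arcs of a set partition are the pairs
`(i, j)` of consecutive elements of a block, `i < j`. -/

/-- Row insertion (Robinson–Schensted–Knuth) of `x` into a tableau: in the first row `x` replaces
the leftmost entry `y > x`, and `y` is then inserted into the rows below; if there is no such entry,
then `x` is put at the end of the row. -/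
def rowInsert : ℕ → List (List ℕ) → List (List ℕ)
  | x, [] => [[x]]
  | x, r :: t =>
    match r.find? (fun y => decide (x < y)) with
    | none => (r ++ [x]) :: t
    | some y => r.replace y x :: rowInsert y t

/-- Remove the square with entry `j` from a tableau (in the use below `j` is its largest entry). -/
def removeEntry (j : ℕ) (T : List (List ℕ)) : List (List ℕ) :=
  (T.map fun r => r.erase j).filter fun r => !r.isEmpty

/-- If `j` is the left endpoint of an arc, remove `j` from the tableau; else do nothing. -/
def deleteStep {n : ℕ} (P : SetPartition n) (j : ℕ) (T : List (List ℕ)) : List (List ℕ) :=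
  if ((P.part j).filter fun k => j < k).Nonempty then removeEntry j T else T

/-- If `j` is the right endpoint of an arc `(i, j)`, insert `i` into the tableau; else do
nothing. -/
def insertStep {n : ℕ} (P : SetPartition n) (j : ℕ) (T : List (List ℕ)) : List (List ℕ) :=
  if h : ((P.part j).filter fun i => i < j).Nonempty then
    rowInsert (((P.part j).filter fun i => i < j).max' h) T
  else T

/-- The tableau reached from the empty tableau after reading the `k` numbers
`j = n, n - 1, …, n - k + 1`, in this order, doing for each `j` first the deletion step and then the
insertion step. -/
def cddsyRead {n : ℕ} (P : SetPartition n) : ℕ → List (List ℕ)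
  | 0 => []
  | k + 1 => insertStep P (n - k) (deleteStep P (n - k) (cddsyRead P k))

/-- The tableaux `T₀, …, T₂ₙ` of a set partition: `T₂ₙ = ∅`, and reading `j = n, …, 1`,
`T₂ⱼ₋₁` is `T₂ⱼ` after the deletion step for `j`, and `T₂ⱼ₋₂` is `T₂ⱼ₋₁` after the insertion step
for `j`. -/
def cddsyTableau {n : ℕ} (P : SetPartition n) (m : ℕ) : List (List ℕ) :=
  if m % 2 = 0 then cddsyRead P (n - m / 2)
  else deleteStep P (m / 2 + 1) (cddsyRead P (n - (m / 2 + 1)))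

/-- `φ` is the Chen–Deng–Du–Stanley–Yan map: the `m`-th partition of `φ P` is the shape of the
tableau `Tₘ` of `P` (`rowLens` is the list of the nonzero parts of a partition). -/
def IsCDDSYMap {n : ℕ} (φ : SetPartition n → VacillatingTableau n ⊥) : Prop :=
  ∀ (P : SetPartition n) (m : Fin (2 * n + 1)),
    ((φ P).shape m).rowLens = (cddsyTableau P m).map List.length

/-! ### Odd Fibonacci numbers, and Motzkin paths -/

/-- The odd Fibonacci numbers `F₂ₙ₋₁`: `F₋₁ = F₁ = 1` and `F₂ₙ₊₃ = 3 F₂ₙ₊₁ - F₂ₙ₋₁`. -/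
def oddFib : ℕ → ℤ
  | 0 => 1
  | 1 => 1
  | n + 2 => 3 * oddFib (n + 1) - oddFib n

/-- The Young diagram of the partition `(1)`. -/
def oneSquare : YoungDiagram where
  cells := {(0, 0)}
  isLowerSet := by
    intro a b hba ha
    have h : a = (0, 0) := by simpa using ha
    subst h
    have h0 : b = (0, 0) := le_antisymm hba ⟨Nat.zero_le _, Nat.zero_le _⟩
    simp [h0]

/-- The vacillating tableaux of empty shape and length `2 n` all of whose partitions are `∅` or
`(1)`. -/
def flatTableaux (n : ℕ) : Set (VacillatingTableau n ⊥) :=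
  {V | ∀ i, V.shape i = ⊥ ∨ V.shape i = oneSquare}

/-- Motzkin paths of length `n`, given by their heights `h₀, …, hₙ ∈ ℕ`. -/
@[ext]
structure MotzkinPath (n : ℕ) where
  height : Fin (n + 1) → ℕ
  height_zero : height 0 = 0
  height_last : height (Fin.last n) = 0
  step : ∀ i : Fin n, height i.succ = height i.castSucc + 1 ∨
    height i.succ = height i.castSucc ∨ height i.succ + 1 = height i.castSucc

/-- Motzkin paths of length `n` and height at most `1`, in which every level step at height `1`
carries a label `0` or `1` (and no other step carries a label). -/
@[ext]
structure ColouredMotzkinPath (n : ℕ) extends MotzkinPath n where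
  height_le : ∀ i, height i ≤ 1
  label : Fin n → Option (Fin 2)
  label_isSome : ∀ i : Fin n,
    (label i).isSome ↔ height i.castSucc = 1 ∧ height i.succ = 1

open Classical in
/-- The path of a vacillating tableau with all shapes `∅` or `(1)`: the height at `i` is `0` or `1`
according to whether `λ²ⁱ` is `∅` or `(1)`, and a level step from `i` to `i + 1` at height `1` gets
the label `0` or `1` according to whether `λ²ⁱ⁺¹` is `(1)` or `∅`. -/
noncomputable def toMotzkin {n : ℕ} (V : flatTableaux n) : ColouredMotzkinPath n where
  height i := if V.1.shape ⟨2 * i, by omega⟩ = ⊥ then 0 else 1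
  height_zero := if_pos V.1.shape_zero
  height_last := if_pos V.1.shape_last
  step i := by split_ifs <;> simp
  height_le i := by split_ifs <;> simp
  label i :=
    if V.1.shape ⟨2 * i, by omega⟩ ≠ ⊥ ∧ V.1.shape ⟨2 * i + 2, by omega⟩ ≠ ⊥ then
      some (if V.1.shape ⟨2 * i + 1, by omega⟩ = ⊥ then 1 else 0)
    else none
  label_isSome i := by
    simp only [Fin.val_castSucc, Fin.val_succ, Nat.mul_add, Nat.mul_one]
    split_ifs <;> simp_all

/-! Every step of the Chen–Deng–Du–Stanley–Yan procedure is reversible once the shapes are known.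
The tableau T₂ᵢ has distinct entries, namely the z ≤ i with an arc (z, k), k > i
(`cddsyTableau_even_spec`). Hence i + 1, if it occurs in T₂ᵢ₊₂, is the largest entry there and sits
in a corner, so deleting it removes one square from the shape; inserting the left endpoint of the
arc ending in i + 1 adds one. This makes the map well defined.

For the inverse, read the shapes from left to right, starting from the empty tableau. A square lost
between λ²ⁱ and λ²ⁱ⁺¹ calls for a reverse row insertion, and the ejected number is the left endpoint
of the arc ending in i + 1. A square gained between λ²ⁱ⁺¹ and λ²ⁱ⁺² is filled with i + 1. Uniqueness
of these operations (`rowInsert_inj`, `AppendsEntry.unique`) gives injectivity. Their existence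
(`exists_inserts`, `exists_appendsEntry`) gives surjectivity: each number enters at most once and,
as the last tableau is empty, every number that enters leaves exactly once, so the ejections form
the arcs of a set partition (`exists_setPartition`).

The bijection carries the fixed points in question to the tableaux of self-conjugate shapes. Adding
a square to (1) gives (2) or (1, 1), neither self-conjugate, so starting from ∅ only ∅ and (1) can
occur (`fixedPoints_conjugateTableau`). Such a sequence is free at an odd index only when both
neighbours are (1), which is the label of a level step at height 1. Counting by the last shape gives
the recursion (a, b) ↦ (a + b, a + 2 b), hence the odd Fibonacci numbers. -/

/-! ### Rows, tableaux and their shapes -/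

/-- The number of entries of the row `r` that are less than `v`. -/
def countLT (r : List ℕ) (v : ℕ) : ℕ := r.countP (fun z => decide (z < v))

@[simp] theorem countLT_nil (v : ℕ) : countLT [] v = 0 := rfl

@[simp] theorem countLT_append (a b : List ℕ) (v : ℕ) :
    countLT (a ++ b) v = countLT a v + countLT b v := List.countP_append

@[simp] theorem countLT_cons (x : ℕ) (b : List ℕ) (v : ℕ) :
    countLT (x :: b) v = countLT b v + if x < v then 1 else 0 := by
  simp [countLT, List.countP_cons]

theorem countLT_mono (r : List ℕ) {v w : ℕ} (h : v ≤ w) : countLT r v ≤ countLT r w :=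
  List.countP_mono_left fun z _ hz => by simp at hz ⊢; omega

theorem countLT_le_length (r : List ℕ) (v : ℕ) : countLT r v ≤ r.length := List.countP_le_length

theorem countLT_eq_length {r : List ℕ} {v : ℕ} (h : ∀ z ∈ r, z < v) :
    countLT r v = r.length := List.countP_eq_length.2 (by simpa using h)

theorem countLT_eq_zero {r : List ℕ} {v : ℕ} (h : ∀ z ∈ r, v ≤ z) :
    countLT r v = 0 := List.countP_eq_zero.2 (by simpa using h)

theorem countLT_pos {r : List ℕ} {v : ℕ} : 0 < countLT r v ↔ ∃ z ∈ r, z < v := by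
  simp [countLT, List.countP_pos_iff]

theorem countLT_succ_of_notMem {r : List ℕ} {v : ℕ} (h : v ∉ r) :
    countLT r (v + 1) = countLT r v :=
  List.countP_congr fun z hz => by
    have : z ≠ v := fun e => h (e ▸ hz)
    simp; omega

theorem countLT_succ_of_mem {r : List ℕ} {v : ℕ} (h : v ∈ r) :
    countLT r v + 1 ≤ countLT r (v + 1) := by
  obtain ⟨a, b, rfl⟩ := List.append_of_mem h
  have := countLT_mono a (Nat.le_succ v)
  have := countLT_mono b (Nat.le_succ v)
  simp at *; omega

theorem exists_forall_lt (r : List ℕ) : ∃ v, ∀ z ∈ r, z < v := by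
  induction r with
  | nil => exact ⟨0, by simp⟩
  | cons a r ih =>
    obtain ⟨v, hv⟩ := ih
    refine ⟨max v (a + 1), ?_⟩
    intro z hz
    rcases List.mem_cons.1 hz with rfl | hz
    · omega
    · have := hv z hz; omega

/-- Tableaux with pairwise distinct entries, as lists of rows. As the entries are distinct, columns
increase if and only if for every `v` each row has at most as many entries below `v` as the
previous row. -/
def IsTableau : List (List ℕ) → Prop
  | [] => True
  | r :: t => r ≠ [] ∧ r.Pairwise (· < ·) ∧ (∀ x ∈ r, x ∉ t.flatten) ∧
      (∀ v, countLT (t.headD []) v ≤ countLT r v) ∧ IsTableau t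

/-- `m` is the list `l` of row lengths with one square added. -/
inductive AddsCell : List ℕ → List ℕ → Prop
  | nil : AddsCell [] [1]
  | here (a : ℕ) (l : List ℕ) : AddsCell (a :: l) ((a + 1) :: l)
  | there (a : ℕ) {l m : List ℕ} : AddsCell l m → AddsCell (a :: l) (a :: m)

theorem AddsCell.sum {l m : List ℕ} (h : AddsCell l m) : m.sum = l.sum + 1 := by
  induction h <;> simp_all <;> omega

/-- This is what lets the shapes alone decide whether an insertion or a deletion took place. -/
theorem AddsCell.ne {l m : List ℕ} (h : AddsCell l m) : l ≠ m := by
  rintro rfl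
  have := h.sum
  omega

/-- The list of row lengths of a tableau. -/
def rowLengths (T : List (List ℕ)) : List ℕ := T.map List.length

@[simp] theorem rowLengths_nil : rowLengths [] = [] := rfl
@[simp] theorem rowLengths_cons (r : List ℕ) (t : List (List ℕ)) :
    rowLengths (r :: t) = r.length :: rowLengths t := rfl

theorem length_le_of_countLT_le {r s : List ℕ} (h : ∀ v, countLT s v ≤ countLT r v) :
    s.length ≤ r.length := by
  obtain ⟨v, hv⟩ := exists_forall_lt s
  rw [← countLT_eq_length hv]
  exact (h v).trans (countLT_le_length r v)

theorem IsTableau.pos {T : List (List ℕ)} (h : IsTableau T) : ∀ a ∈ rowLengths T, 0 < a := by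
  induction T with
  | nil => simp
  | cons r t ih =>
    obtain ⟨h1, -, -, -, h5⟩ := h
    intro a ha
    rcases List.mem_cons.1 ha with rfl | ha
    · exact List.length_pos_iff.2 h1
    · exact ih h5 a ha

theorem IsTableau.isChain {T : List (List ℕ)} (h : IsTableau T) :
    (rowLengths T).IsChain (· ≥ ·) := by
  induction T with
  | nil => simp
  | cons r t ih =>
    obtain ⟨-, -, -, h4, h5⟩ := h
    cases t with
    | nil => simp
    | cons s t =>
      refine List.isChain_cons_cons.2 ⟨length_le_of_countLT_le h4, ih h5⟩

/-- Comparing counts below z + 1 gives an entry x ≤ z one row up, and distinctness makes it strict;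
then climb row by row. Reverse insertion needs this to find an entry to displace. -/
theorem IsTableau.exists_lt_of_mem {r : List ℕ} {t : List (List ℕ)} (h : IsTableau (r :: t))
    {y : ℕ} (hy : y ∈ t.flatten) : ∃ x ∈ r, x < y := by
  induction t generalizing r with
  | nil => simp at hy
  | cons s t ih =>
    obtain ⟨-, -, h3, h4, h5⟩ := h
    have key : ∀ z ∈ s, ∃ x ∈ r, x < z := by
      intro z hz
      have h1 : 0 < countLT r (z + 1) :=
        (countLT_pos.2 ⟨z, hz, Nat.lt_succ_self z⟩).trans_le (h4 (z + 1))
      obtain ⟨x, hx, hxz⟩ := countLT_pos.1 h1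
      have hne : x ≠ z := fun e => h3 x hx (by simp [e, hz])
      exact ⟨x, hx, by omega⟩
    rw [List.flatten_cons, List.mem_append] at hy
    rcases hy with hy | hy
    · exact key y hy
    · obtain ⟨z, hz, hzy⟩ := ih h5 hy
      obtain ⟨x, hx, hxz⟩ := key z hz
      exact ⟨x, hx, hxz.trans hzy⟩

/-! ### Row insertion -/

/-- The graph of row insertion. -/
inductive Inserts : ℕ → List (List ℕ) → List (List ℕ) → Prop
  | nil (x : ℕ) : Inserts x [] [[x]]
  | append {x : ℕ} {r : List ℕ} (t : List (List ℕ)) (h : ∀ z ∈ r, z ≤ x) :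
      Inserts x (r :: t) ((r ++ [x]) :: t)
  | bump {x y : ℕ} {a b : List ℕ} {t u : List (List ℕ)} (ha : ∀ z ∈ a, z ≤ x) (hxy : x < y)
      (h : Inserts y t u) : Inserts x ((a ++ y :: b) :: t) ((a ++ x :: b) :: u)

/-- The relation displays the split `a ++ y :: b` of a bumped row, which the recursive function
hides behind `find?` and `replace`. Both hit this y, because all entries of `a` are at most x < y.
-/
theorem Inserts.rowInsert_eq {x : ℕ} {T U : List (List ℕ)} (h : Inserts x T U) :
    rowInsert x T = U := by
  induction h with
  | nil x => rfl
  | append t h =>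
    rw [rowInsert, List.find?_eq_none.2 (by simpa using h)]
  | @bump x y a b t u ha hxy h ih =>
    have h1 : (a ++ y :: b).find? (fun y => decide (x < y)) = some y := by
      rw [List.find?_append, List.find?_eq_none.2 (by simpa using ha)]
      simp [hxy]
    have h2 : y ∉ a := fun hy => by have := ha y hy; omega
    rw [rowInsert, h1]
    simp [List.replace_append, h2, ih]

theorem row_cases (x : ℕ) (r : List ℕ) : (∀ z ∈ r, z ≤ x) ∨
    ∃ a y b, r = a ++ y :: b ∧ (∀ z ∈ a, z ≤ x) ∧ x < y := by
  induction r with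
  | nil => simp
  | cons c r ih =>
    by_cases hc : x < c
    · exact Or.inr ⟨[], c, r, by simp, by simp, hc⟩
    · rcases ih with ih | ⟨a, y, b, rfl, ha, hy⟩
      · left; simpa using ⟨by omega, ih⟩
      · refine Or.inr ⟨c :: a, y, b, by simp, ?_, hy⟩
        simpa using ⟨by omega, ha⟩

theorem inserts_rowInsert (x : ℕ) (T : List (List ℕ)) : Inserts x T (rowInsert x T) := by
  suffices h : ∃ U, Inserts x T U by
    obtain ⟨U, hU⟩ := h
    rwa [hU.rowInsert_eq]
  induction T generalizing x with
  | nil => exact ⟨_, .nil x⟩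
  | cons r t ih =>
    rcases row_cases x r with h | ⟨a, y, b, rfl, ha, hy⟩
    · exact ⟨_, .append t h⟩
    · obtain ⟨u, hu⟩ := ih y
      exact ⟨_, .bump ha hy hu⟩

theorem Inserts.mem_iff {x : ℕ} {T U : List (List ℕ)} (h : Inserts x T U) (z : ℕ) :
    z ∈ U.flatten ↔ z = x ∨ z ∈ T.flatten := by
  induction h with
  | nil x => simp
  | append t h => simp; tauto
  | bump ha hxy h ih => simp only [List.flatten_cons, List.mem_append, List.mem_cons, ih]; tauto

theorem Inserts.addsCell {x : ℕ} {T U : List (List ℕ)} (h : Inserts x T U) :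
    AddsCell (rowLengths T) (rowLengths U) := by
  induction h with
  | nil x => exact .nil
  | append t h => simpa using .here _ _
  | bump ha hxy h ih => simpa using .there _ ih

theorem Inserts.mem_headD {x : ℕ} {T U : List (List ℕ)} (h : Inserts x T U) :
    x ∈ U.headD [] := by
  cases h <;> simp

theorem Inserts.countLT_le {x : ℕ} {T U : List (List ℕ)} (h : Inserts x T U) (v : ℕ) :
    countLT (T.headD []) v ≤ countLT (U.headD []) v := by
  cases h <;> simp
  split_ifs <;> omega

theorem Inserts.countLT_eq {x : ℕ} {T U : List (List ℕ)} (h : Inserts x T U) {v : ℕ}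
    (hv : v ≤ x) : countLT (U.headD []) v = countLT (T.headD []) v := by
  cases h <;> simp
  all_goals try split_ifs
  all_goals omega

/-- The new entry x lands just after the entries smaller than x. If v does not exceed the bumped
entry, only these and x can be counted; beyond it, replacing y by x changes no count. -/
theorem Inserts.countLT_le_max {x : ℕ} {T U : List (List ℕ)} (h : Inserts x T U)
    (hT : IsTableau T) (hx : x ∉ T.flatten) (v : ℕ) :
    countLT (U.headD []) v ≤ max (countLT (T.headD []) x + 1) (countLT (T.headD []) v) := by
  cases h with
  | nil x => simp; split_ifs <;> omega
  | @append x r t h =>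
    have h1 : countLT r x = r.length := countLT_eq_length fun z hz => by
      have := h z hz
      have : z ≠ x := fun e => hx (by simp [← e, hz])
      omega
    have := countLT_le_length r v
    simp; split_ifs <;> omega
  | @bump x y a b t u ha hxy h =>
    have h1 : countLT a x = a.length := countLT_eq_length fun z hz => by
      have := ha z hz
      have : z ≠ x := fun e => hx (by simp [← e, hz])
      omega
    have h2 := countLT_le_length a v
    have h3 : v ≤ y → countLT b v = 0 := fun hv => countLT_eq_zero fun z hz => by
      have := (List.pairwise_cons.1 (List.pairwise_append.1 hT.2.1).2.1).1 z hz
      omega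
    simp
    split_ifs <;> omega

theorem Inserts.isTableau {x : ℕ} {T U : List (List ℕ)} (h : Inserts x T U)
    (hT : IsTableau T) (hx : x ∉ T.flatten) : IsTableau U := by
  induction h with
  | nil x => simp [IsTableau]
  | @append x r t h =>
    obtain ⟨h1, h2, h3, h4, h5⟩ := hT
    simp only [List.flatten_cons, List.mem_append, not_or] at hx
    refine ⟨by simp, ?_, ?_, fun v => ?_, h5⟩
    · rw [List.pairwise_append]
      refine ⟨h2, by simp, fun z hz w hw => ?_⟩
      obtain rfl : w = x := by simpa using hw
      have := h z hz
      have : z ≠ w := fun e => hx.1 (e ▸ hz)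
      omega
    · intro z hz
      rcases List.mem_append.1 hz with hz | hz
      · exact h3 z hz
      · obtain rfl : z = x := by simpa using hz
        exact hx.2
    · have := h4 v
      simp only [List.headD_eq_head?_getD, countLT_append] at this ⊢; omega
  | @bump x y a b t u ha hxy h ih =>
    obtain ⟨h1, h2, h3, h4, h5⟩ := hT
    simp only [List.flatten_cons, List.mem_append, List.mem_cons, not_or] at hx
    have hyt : y ∉ t.flatten := h3 y (by simp)
    have hay : ∀ z ∈ a, z < x := fun z hz => by
      have := ha z hz
      have : z ≠ x := fun e => hx.1.1 (e ▸ hz)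
      omega
    obtain ⟨h21, h22, h23⟩ := List.pairwise_append.1 h2
    obtain ⟨h24, h25⟩ := List.pairwise_cons.1 h22
    refine ⟨by simp, ?_, ?_, fun v => ?_, ih h5 hyt⟩
    · refine List.pairwise_append.2 ⟨h21, List.pairwise_cons.2 ⟨fun z hz => hxy.trans (h24 z hz),
        h25⟩, fun z hz w hw => ?_⟩
      rcases List.mem_cons.1 hw with rfl | hw
      · exact hay z hz
      · exact h23 z hz w (by simp [hw])
    · intro z hz hzu
      rcases (h.mem_iff z).1 hzu with rfl | hzt
      · rcases List.mem_append.1 hz with hz | hz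
        · have := hay z hz; omega
        · rcases List.mem_cons.1 hz with rfl | hz
          · omega
          · have := h24 z hz; omega
      · rcases List.mem_append.1 hz with hz | hz
        · exact h3 z (by simp [hz]) hzt
        · rcases List.mem_cons.1 hz with rfl | hz
          · exact hx.2 hzt
          · exact h3 z (by simp [hz]) hzt
    · have e1 := h.countLT_le_max h5 hyt v
      have e2 := h4 v
      have e3 := h4 y
      have e4 : countLT (a ++ y :: b) v ≤ countLT (a ++ x :: b) v := by
        simp; split_ifs <;> omega
      -- Up to y the count in the row below is unchanged. Beyond y it may have grown to one more
      -- than the number of entries below y, and the old upper row, which contained y, has room for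
      -- that extra unit.
      rcases le_or_gt v y with hv | hv
      · rw [h.countLT_eq hv]; omega
      · have e5 := countLT_succ_of_mem (r := a ++ y :: b) (v := y) (by simp)
        have e6 := countLT_mono (a ++ y :: b) (v := y + 1) (w := v) hv
        omega

/-! ### Reversing row insertion -/

/-- If the two positions differed, one of x, x' would lie to the right of the other split and so
exceed y. -/
theorem split_unique {x y x' : ℕ} {a b a' b' : List ℕ} (hs : (a ++ y :: b).Pairwise (· < ·))
    (hs' : (a' ++ y :: b').Pairwise (· < ·)) (hx : x < y) (hx' : x' < y)
    (h : a ++ x :: b = a' ++ x' :: b') : a = a' ∧ x = x' ∧ b = b' := by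
  have hb : ∀ z ∈ b, y < z := (List.pairwise_cons.1 (List.pairwise_append.1 hs).2.1).1
  have hb' : ∀ z ∈ b', y < z := (List.pairwise_cons.1 (List.pairwise_append.1 hs').2.1).1
  rcases List.append_eq_append_iff.1 h with ⟨c, hc, hd⟩ | ⟨c, hc, hd⟩
  · cases c with
    | nil => simp at hc hd; tauto
    | cons e c =>
      simp at hd
      have := hb x' (by simp [hd.2])
      omega
  · cases c with
    | nil => simp at hc hd; simp [*]
    | cons e c =>
      simp at hd
      have := hb' x (by simp [hd.2])
      omega

/-- Appending lengthens a row and bumping does not, so equal shapes before and after force the same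
rule in each row. Below a bump the induction recovers y, and y locates the place where it was
bumped. -/
theorem Inserts.unique_of_eq {x x' : ℕ} {T T' U U' : List (List ℕ)} (h : Inserts x T U)
    (h' : Inserts x' T' U') (e : U = U') (hT : IsTableau T) (hT' : IsTableau T')
    (hl : rowLengths T = rowLengths T') : x = x' ∧ T = T' := by
  induction h generalizing x' T' U' with
  | nil x =>
    cases h' with
    | nil => simpa using e
    | append => simp at hl
    | bump => simp at hl
  | @append x r t h =>
    cases h' with
    | nil => simp at hl
    | @append _ r' t' h' =>
      simp only [List.cons.injEq] at e
      obtain ⟨e1, rfl⟩ := e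
      have := List.append_inj' e1 rfl
      simp_all
    | bump ha hxy h' =>
      simp only [List.cons.injEq, rowLengths_cons] at e hl
      have := congrArg List.length e.1
      simp at this hl
      omega
  | @bump x y a b t u ha hxy h ih =>
    cases h' with
    | nil => simp at hl
    | append t h' =>
      simp only [List.cons.injEq, rowLengths_cons] at e hl
      have := congrArg List.length e.1
      simp at this hl
      omega
    | bump ha' hxy' h' =>
      simp only [List.cons.injEq, rowLengths_cons] at e hl
      obtain ⟨rfl, rfl⟩ := ih h' e.2 hT.2.2.2.2 hT'.2.2.2.2 hl.2
      obtain ⟨rfl, rfl, rfl⟩ := split_unique hT.2.1 hT'.2.1 hxy hxy' e.1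
      exact ⟨rfl, rfl⟩

theorem rowInsert_inj {x x' : ℕ} {T T' : List (List ℕ)} (hT : IsTableau T) (hT' : IsTableau T')
    (hl : rowLengths T = rowLengths T') (h : rowInsert x T = rowInsert x' T') :
    x = x' ∧ T = T' :=
  (inserts_rowInsert x T).unique_of_eq (inserts_rowInsert x' T') h hT hT' hl

theorem rows_of_tail_lengths_nil {t : List (List ℕ)} (h : [] = rowLengths t) : t = [] := by
  simpa [rowLengths] using h.symm

/-- The entry x found here is the one that y displaces in reverse insertion: putting y in its place
keeps the row increasing. -/
theorem exists_last_lt {r : List ℕ} {y : ℕ} (hs : r.Pairwise (· < ·)) (hy : y ∉ r)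
    (h : ∃ x ∈ r, x < y) :
    ∃ a x b, r = a ++ x :: b ∧ x < y ∧ (∀ z ∈ a, z < x) ∧ (∀ z ∈ b, y < z) := by
  induction r with
  | nil => simp at h
  | cons c r ih =>
    simp only [List.mem_cons, not_or] at hy
    obtain ⟨h1, h2⟩ := List.pairwise_cons.1 hs
    by_cases hr : ∃ x ∈ r, x < y
    · obtain ⟨a, x, b, rfl, hxy, ha, hb⟩ := ih h2 hy.2 hr
      refine ⟨c :: a, x, b, by simp, hxy, ?_, hb⟩
      intro z hz
      rcases List.mem_cons.1 hz with rfl | hz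
      · exact h1 x (by simp)
      · exact ha z hz
    · push Not at hr
      obtain ⟨x, hx, hxy⟩ := h
      rcases List.mem_cons.1 hx with rfl | hx
      · refine ⟨[], x, r, by simp, hxy, by simp, fun z hz => ?_⟩
        have := hr z hz
        have : z ≠ y := fun e => hy.2 (e ▸ hz)
        omega
      · have := hr x hx; omega

/-- Reverse row insertion. -/
theorem exists_inserts {l : List ℕ} {U : List (List ℕ)} (h : AddsCell l (rowLengths U))
    (hl : l.IsChain (· ≥ ·)) (hpos : ∀ a ∈ l, 0 < a) (hU : IsTableau U) :
    ∃ x T, Inserts x T U ∧ IsTableau T ∧ x ∉ T.flatten ∧ rowLengths T = l := by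
  generalize hm : rowLengths U = m at h
  induction h generalizing U with
  | nil =>
    cases U with
    | nil => simp at hm
    | cons r t =>
      simp only [rowLengths_cons, List.cons.injEq] at hm
      obtain rfl := rows_of_tail_lengths_nil hm.2.symm
      obtain ⟨x, rfl⟩ := List.length_eq_one_iff.1 hm.1
      exact ⟨x, [], .nil x, trivial, by simp, rfl⟩
  | here a l =>
    cases U with
    | nil => simp at hm
    | cons r t =>
      simp only [rowLengths_cons, List.cons.injEq] at hm
      obtain ⟨h1, h2, h3, h4, h5⟩ := hU
      obtain ⟨r, x, rfl⟩ := (List.eq_nil_or_concat r).resolve_left h1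
      simp only [List.concat_eq_append] at *
      obtain ⟨h21, -, h23⟩ := List.pairwise_append.1 h2
      have hlen : r.length = a := by simpa using hm.1
      have hx : ∀ z ∈ r, z < x := fun z hz => h23 z hz x (by simp)
      refine ⟨x, r :: t, .append t fun z hz => (hx z hz).le, ⟨?_, h21,
        fun z hz => h3 z (by simp [hz]), fun v => ?_, h5⟩, ?_, by simp [hlen, hm.2]⟩
      · rintro rfl
        have := hpos a (by simp)
        simp at hlen; omega
      -- For v ≤ x the removed last entry was not counted. For v > x the whole shortened row is
      -- counted, and the prescribed shape bounds the length of the next row.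
      · rcases le_or_gt v x with hv | hv
        · have := h4 v
          simp only [countLT_append, countLT_cons, countLT_nil] at this
          rw [if_neg (by omega)] at this
          simpa using this
        · rw [countLT_eq_length (r := r) fun z hz => (hx z hz).trans hv, hlen]
          refine (countLT_le_length _ v).trans ?_
          cases t with
          | nil => simp
          | cons s t =>
            rw [← hm.2] at hl
            exact (List.isChain_cons_cons.1 hl).1
      · simp only [List.flatten_cons, List.mem_append, not_or]
        exact ⟨fun h => (hx x h).false, h3 x (by simp)⟩
  | @there a l m h ih =>
    cases U with
    | nil => simp at hm
    | cons r t =>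
      simp only [rowLengths_cons, List.cons.injEq] at hm
      have hU' := hU
      obtain ⟨h1, h2, h3, h4, h5⟩ := hU
      obtain ⟨y, T, hi, hT, hyT, hTl⟩ := ih hl.of_cons (fun a ha => hpos a (by simp [ha])) h5 hm.2
      have hyt : y ∈ t.flatten := (hi.mem_iff y).2 (Or.inl rfl)
      have hyr : y ∉ r := fun h => h3 y h hyt
      obtain ⟨p, x, q, rfl, hxy, hp, hq⟩ := exists_last_lt h2 hyr (hU'.exists_lt_of_mem hyt)
      obtain ⟨h21, h22, h23⟩ := List.pairwise_append.1 h2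
      obtain ⟨h24, h25⟩ := List.pairwise_cons.1 h22
      have hTt : ∀ z ∈ T.flatten, z ∈ t.flatten := fun z hz => (hi.mem_iff z).2 (Or.inr hz)
      refine ⟨x, (p ++ y :: q) :: T, .bump (fun z hz => (hp z hz).le) hxy hi,
        ⟨by simp, ?_, ?_, fun v => ?_, hT⟩, ?_, ?_⟩
      · refine List.pairwise_append.2 ⟨h21, List.pairwise_cons.2 ⟨hq, h25⟩, fun z hz w hw => ?_⟩
        rcases List.mem_cons.1 hw with rfl | hw
        · exact (hp z hz).trans hxy
        · exact h23 z hz w (by simp [hw])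
      · intro z hz
        rcases List.mem_append.1 hz with hz | hz
        · exact fun h => h3 z (by simp [hz]) (hTt z h)
        · rcases List.mem_cons.1 hz with rfl | hz
          · exact hyT
          · exact fun h => h3 z (by simp [hz]) (hTt z h)
      · have e1 := hi.countLT_le v
        have e2 := h4 v
        simp only [countLT_append, countLT_cons] at e2 ⊢
        -- Only in this range does replacing x by y lower the count, to the length of `p`. Since y
        -- lies in the first row of `t`, that row has at least one entry fewer below y than below y
        -- + 1, and this spare unit saves the inequality.
        by_cases hv : x < v ∧ v ≤ y
        · have e3 := countLT_succ_of_mem hi.mem_headD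
          have e4 := h4 (y + 1)
          have e5 := countLT_mono (t.headD []) hv.2
          rw [countLT_succ_of_notMem hyr] at e4
          have e6 : countLT q y = 0 := countLT_eq_zero fun z hz => (hq z hz).le
          have e7 : countLT p v = p.length := countLT_eq_length fun z hz => (hp z hz).trans hv.1
          have e8 := countLT_le_length p y
          simp only [countLT_append, countLT_cons] at e4
          rw [if_pos hxy] at e4
          omega
        · split_ifs at * <;> omega
      · simp only [List.flatten_cons, List.mem_append, List.mem_cons, not_or]
        refine ⟨⟨fun h => (hp x h).false, hxy.ne, fun h => (h24 x h).false⟩,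
          fun h => h3 x (by simp) (hTt x h)⟩
      · have := hm.1
        simpa [hTl] using this

/-! ### Appending and removing a largest entry -/

/-- `T` is `S` with the entry `j` appended to one of the rows. -/
inductive AppendsEntry (j : ℕ) : List (List ℕ) → List (List ℕ) → Prop
  | nil : AppendsEntry j [] [[j]]
  | here (r : List ℕ) (t : List (List ℕ)) : AppendsEntry j (r :: t) ((r ++ [j]) :: t)
  | there (r : List ℕ) {t u : List (List ℕ)} : AppendsEntry j t u → AppendsEntry j (r :: t) (r :: u)

theorem AppendsEntry.addsCell {j : ℕ} {S T : List (List ℕ)} (h : AppendsEntry j S T) :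
    AddsCell (rowLengths S) (rowLengths T) := by
  induction h with
  | nil => exact .nil
  | here r t => simpa using .here _ _
  | there r h ih => exact .there _ ih

theorem AppendsEntry.mem_iff {j : ℕ} {S T : List (List ℕ)} (h : AppendsEntry j S T) (z : ℕ) :
    z ∈ T.flatten ↔ z = j ∨ z ∈ S.flatten := by
  induction h with
  | nil => simp
  | here r t => simp; tauto
  | there r h ih => simp only [List.flatten_cons, List.mem_append, ih]; tauto

theorem AppendsEntry.unique {j : ℕ} {S T T' : List (List ℕ)} (h : AppendsEntry j S T)
    (h' : AppendsEntry j S T') (hl : rowLengths T = rowLengths T') : T = T' := by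
  induction h generalizing T' with
  | nil => cases h'; rfl
  | here r t =>
    cases h' with
    | here => rfl
    | there => simp at hl
  | there r h ih =>
    cases h' with
    | here => simp at hl
    | there _ h' =>
      simp only [rowLengths_cons, List.cons.injEq, true_and] at hl
      rw [ih h' hl]

theorem exists_appendsEntry (j : ℕ) {S : List (List ℕ)} {m : List ℕ}
    (h : AddsCell (rowLengths S) m) : ∃ T, AppendsEntry j S T ∧ rowLengths T = m := by
  generalize hl : rowLengths S = l at h
  induction h generalizing S with
  | nil =>
    obtain rfl := rows_of_tail_lengths_nil hl.symm
    exact ⟨_, .nil, rfl⟩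
  | here a l =>
    cases S with
    | nil => simp at hl
    | cons r t =>
      simp only [rowLengths_cons, List.cons.injEq] at hl
      exact ⟨_, .here r t, by simp [hl]⟩
  | there a h ih =>
    cases S with
    | nil => simp at hl
    | cons r t =>
      simp only [rowLengths_cons, List.cons.injEq] at hl
      obtain ⟨u, hu, e⟩ := ih hl.2
      exact ⟨_, .there r hu, by simp [hl, e]⟩

theorem AppendsEntry.countLT_eq {j : ℕ} {S T : List (List ℕ)} (h : AppendsEntry j S T) {v : ℕ}
    (hv : v ≤ j) : countLT (T.headD []) v = countLT (S.headD []) v := by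
  cases h <;> simp <;> omega

theorem AppendsEntry.countLT_le {j : ℕ} {S T : List (List ℕ)} (h : AppendsEntry j S T) (v : ℕ) :
    countLT (S.headD []) v ≤ countLT (T.headD []) v := by
  cases h <;> simp

/-- Counts below v ≤ j are untouched, and for v > j the old rows are counted in full, so the column
condition reduces to the shape being a partition. -/
theorem AppendsEntry.isTableau {j : ℕ} {S T : List (List ℕ)} (h : AppendsEntry j S T)
    (hS : IsTableau S) (hj : ∀ z ∈ S.flatten, z < j) (hT : (rowLengths T).IsChain (· ≥ ·)) :
    IsTableau T := by
  induction h with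
  | nil => simp [IsTableau]
  | here r t =>
    obtain ⟨h1, h2, h3, h4, h5⟩ := hS
    simp only [List.flatten_cons, List.mem_append] at hj
    refine ⟨by simp, ?_, ?_, fun v => ?_, h5⟩
    · refine List.pairwise_append.2 ⟨h2, by simp, fun z hz w hw => ?_⟩
      obtain rfl : w = j := by simpa using hw
      exact hj z (Or.inl hz)
    · intro z hz
      rcases List.mem_append.1 hz with hz | hz
      · exact h3 z hz
      · obtain rfl : z = j := by simpa using hz
        exact fun h => (hj z (Or.inr h)).false
    · have := h4 v
      rw [countLT_append]
      omega
  | @there r t u h ih =>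
    obtain ⟨h1, h2, h3, h4, h5⟩ := hS
    simp only [List.flatten_cons, List.mem_append] at hj
    refine ⟨h1, h2, fun z hz hzu => ?_, fun v => ?_, ih h5 (fun z hz => hj z (Or.inr hz)) hT.of_cons⟩
    · rcases (h.mem_iff z).1 hzu with rfl | hzt
      · exact (hj z (Or.inl hz)).false
      · exact h3 z hz hzt
    · rcases le_or_gt v j with hv | hv
      · rw [h.countLT_eq hv]; exact h4 v
      · rw [countLT_eq_length (r := r) fun z hz => (hj z (Or.inl hz)).trans hv]
        refine (countLT_le_length _ v).trans ?_
        cases u with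
        | nil => simp
        | cons s u => exact (List.isChain_cons_cons.1 hT).1

theorem removeEntry_of_notMem {j : ℕ} {S : List (List ℕ)} (hS : IsTableau S)
    (hj : j ∉ S.flatten) : removeEntry j S = S := by
  induction S with
  | nil => rfl
  | cons r t ih =>
    simp only [List.flatten_cons, List.mem_append, not_or] at hj
    have := ih hS.2.2.2.2 hj.2
    unfold removeEntry at this ⊢
    rw [List.map_cons, List.erase_of_not_mem hj.1, List.filter_cons, this]
    simp [hS.1]

theorem AppendsEntry.removeEntry_eq {j : ℕ} {S T : List (List ℕ)} (h : AppendsEntry j S T)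
    (hS : IsTableau S) (hj : j ∉ S.flatten) : removeEntry j T = S := by
  induction h with
  | nil => simp [removeEntry]
  | here r t =>
    simp only [List.flatten_cons, List.mem_append, not_or] at hj
    have := removeEntry_of_notMem hS.2.2.2.2 hj.2
    unfold removeEntry at this ⊢
    rw [List.map_cons, List.erase_append_right _ hj.1, List.filter_cons, this]
    simp [hS.1]
  | there r h ih =>
    simp only [List.flatten_cons, List.mem_append, not_or] at hj
    have := ih hS.2.2.2.2 hj.2
    unfold removeEntry at this ⊢
    rw [List.map_cons, List.erase_of_not_mem hj.1, List.filter_cons, this]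
    simp [hS.1]

/-- A largest entry ends its row. If it is alone in its row there is no row below, since an entry
there would be larger; otherwise the entries of the next row are below j, so the column condition
survives its removal. -/
theorem exists_appendsEntry_of_mem {j : ℕ} {T : List (List ℕ)} (hT : IsTableau T)
    (hle : ∀ z ∈ T.flatten, z ≤ j) (hj : j ∈ T.flatten) :
    ∃ S, AppendsEntry j S T ∧ IsTableau S ∧ j ∉ S.flatten := by
  induction T with
  | nil => simp at hj
  | cons r t ih =>
    have hT' := hT
    obtain ⟨h1, h2, h3, h4, h5⟩ := hT
    simp only [List.flatten_cons, List.mem_append] at hj hle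
    by_cases hjr : j ∈ r
    · obtain ⟨a, b, rfl⟩ := List.append_of_mem hjr
      obtain ⟨h21, h22, h23⟩ := List.pairwise_append.1 h2
      obtain rfl : b = [] := by
        rcases b with - | ⟨z, b⟩
        · rfl
        · have e1 := (List.pairwise_cons.1 h22).1 z (by simp)
          have e2 := hle z (by simp)
          omega
      have hjt := h3 j hjr
      have ha : ∀ z ∈ a, z < j := fun z hz => h23 z hz j (by simp)
      by_cases hn : a = []
      · subst hn
        have ht : t = [] := by
          cases t with
          | nil => rfl
          | cons s t =>
            obtain ⟨z, s', rfl⟩ := List.exists_cons_of_ne_nil h5.1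
            obtain ⟨w, hw, hwz⟩ := hT'.exists_lt_of_mem (y := z) (by simp)
            have := hle z (by simp)
            obtain rfl : w = j := by simpa using hw
            omega
        subst ht
        exact ⟨[], .nil, trivial, by simp⟩
      · refine ⟨a :: t, .here a t, ⟨hn, h21, fun z hz => h3 z (by simp [hz]), fun v => ?_, h5⟩, ?_⟩
        · have key : ∀ v ≤ j, countLT (t.headD []) v ≤ countLT a v := fun v hv => by
            have := h4 v
            simp only [countLT_append, countLT_cons, countLT_nil] at this
            rw [if_neg (by omega)] at this
            simpa using this
          rcases le_or_gt v j with hv | hv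
          · exact key v hv
          · have hs : ∀ z ∈ t.headD [], z < j := fun z hz => by
              cases t with
              | nil => simp at hz
              | cons s t =>
                have hz' : z ∈ (s :: t).flatten := by
                  simp only [List.headD_cons] at hz
                  simp [hz]
                have := hle z (Or.inr hz')
                have : z ≠ j := fun e => hjt (e ▸ hz')
                omega
            have := key j le_rfl
            rw [countLT_eq_length hs] at this
            rw [countLT_eq_length fun z hz => (hs z hz).trans hv]
            exact this.trans (countLT_mono a hv.le)
        · simp only [List.flatten_cons, List.mem_append, not_or]
          exact ⟨fun h => (ha j h).false, hjt⟩
    · obtain ⟨S, hS, hS', hjS⟩ := ih h5 (fun z hz => hle z (Or.inr hz)) (hj.resolve_left hjr)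
      refine ⟨r :: S, .there r hS, ⟨h1, h2, fun z hz hzS => h3 z hz ((hS.mem_iff z).2 (Or.inr hzS)),
        fun v => (hS.countLT_le v).trans (h4 v), hS'⟩, ?_⟩
      simp only [List.flatten_cons, List.mem_append, not_or]
      exact ⟨hjr, hjS⟩

/-! ### Young diagrams and lists of row lengths -/

theorem YoungDiagram.getD_rowLens (μ : YoungDiagram) (i : ℕ) :
    μ.rowLens.getD i 0 = μ.rowLen i := by
  by_cases h : i < μ.rowLens.length
  · rw [List.getD_eq_getElem _ _ h, YoungDiagram.get_rowLens]
  · rw [List.getD_eq_default _ _ (by omega)]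
    rw [YoungDiagram.length_rowLens] at h
    symm
    by_contra hne
    have h0 : (i, 0) ∈ μ := YoungDiagram.mem_iff_lt_rowLen.2 (Nat.pos_of_ne_zero hne)
    exact h (YoungDiagram.mem_iff_lt_colLen.1 h0)

theorem YoungDiagram.rowLens_injective {l μ : YoungDiagram} (h : l.rowLens = μ.rowLens) : l = μ :=
  YoungDiagram.equivListRowLens.injective (Subtype.ext h)

theorem YoungDiagram.rowLens_bot : (⊥ : YoungDiagram).rowLens = [] := by
  rw [← List.length_eq_zero_iff, YoungDiagram.length_rowLens]
  by_contra h
  exact YoungDiagram.notMem_bot _ (YoungDiagram.mem_iff_lt_colLen.2 (Nat.pos_of_ne_zero h))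

theorem YoungDiagram.rowLens_isChain (μ : YoungDiagram) : μ.rowLens.IsChain (· ≥ ·) :=
  μ.rowLens_sorted.isChain

theorem AddsCell.exists_getD {l m : List ℕ} (h : AddsCell l m) :
    ∃ k, ∀ i, m.getD i 0 = l.getD i 0 + if i = k then 1 else 0 := by
  induction h with
  | nil => exact ⟨0, fun i => by cases i <;> simp⟩
  | here a l => exact ⟨0, fun i => by cases i <;> simp⟩
  | there a h ih =>
    obtain ⟨k, hk⟩ := ih
    refine ⟨k + 1, fun i => ?_⟩
    cases i with
    | zero => simp
    | succ i => simpa using hk i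

theorem eq_nil_of_getD_eq_zero {l : List ℕ} (hpos : ∀ a ∈ l, 0 < a) (h : l.getD 0 0 = 0) :
    l = [] := by
  cases l with
  | nil => rfl
  | cons a l => have := hpos a (by simp); simp at h; omega

theorem eq_of_getD_eq {l m : List ℕ} (hl : ∀ a ∈ l, 0 < a) (hm : ∀ a ∈ m, 0 < a)
    (h : ∀ i, m.getD i 0 = l.getD i 0) : m = l := by
  induction l generalizing m with
  | nil => exact eq_nil_of_getD_eq_zero hm (by simpa using h 0)
  | cons a l ih =>
    cases m with
    | nil => have := h 0; have := hl a (by simp); simp at *; omega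
    | cons b m =>
      have h0 : b = a := by simpa using h 0
      have hl' : ∀ a ∈ l, 0 < a := fun a ha => hl a (by simp [ha])
      have hm' : ∀ a ∈ m, 0 < a := fun a ha => hm a (by simp [ha])
      rw [h0, ih hl' hm' fun i => by simpa using h (i + 1)]

/-- With positive entries, padding by zeros loses no information. This is the bridge between lists
of row lengths and the function `rowLen` of a Young diagram. -/
theorem addsCell_of_getD {l m : List ℕ} (hl : ∀ a ∈ l, 0 < a) (hm : ∀ a ∈ m, 0 < a)
    (hs : m.IsChain (· ≥ ·)) {k : ℕ}
    (h : ∀ i, m.getD i 0 = l.getD i 0 + if i = k then 1 else 0) : AddsCell l m := by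
  induction l generalizing m k with
  | nil =>
    cases m with
    | nil => have := h k; simp at this
    | cons b m =>
      cases m with
      | nil =>
        have h0 := h 0
        have := hm b (by simp)
        simp at h0
        split_ifs at h0
        · subst h0; exact .nil
        · omega
      | cons c m =>
        have h0 := h 0
        have h1 := h 1
        have := hm b (by simp)
        have := hm c (by simp)
        simp at h0 h1
        split_ifs at h0 h1 <;> omega
  | cons a l ih =>
    cases m with
    | nil => have := h 0; have := hl a (by simp); simp at *; omega
    | cons b m =>
      have hl' : ∀ a ∈ l, 0 < a := fun a ha => hl a (by simp [ha])
      have hm' : ∀ a ∈ m, 0 < a := fun a ha => hm a (by simp [ha])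
      cases k with
      | zero =>
        obtain rfl : b = a + 1 := by simpa using h 0
        obtain rfl : m = l := eq_of_getD_eq hl' hm' fun i => by simpa using h (i + 1)
        exact .here a m
      | succ k =>
        obtain rfl : b = a := by simpa using h 0
        exact .there b (ih hl' hm' hs.of_cons fun i => by simpa using h (i + 1))

theorem addsSquare_of_addsCell {l μ : YoungDiagram} (h : AddsCell l.rowLens μ.rowLens) :
    AddsSquare l μ := by
  obtain ⟨k, hk⟩ := h.exists_getD
  simp only [YoungDiagram.getD_rowLens] at hk
  refine ⟨(k, l.rowLen k), ?_, ?_⟩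
  · rw [YoungDiagram.mem_cells, YoungDiagram.mem_iff_lt_rowLen]
    omega
  · ext ⟨i, q⟩
    rw [YoungDiagram.mem_cells, YoungDiagram.mem_iff_lt_rowLen, Finset.mem_insert,
      YoungDiagram.mem_cells, YoungDiagram.mem_iff_lt_rowLen, hk, Prod.mk.injEq]
    split_ifs with h
    · subst h; omega
    · simp [h]

theorem AddsSquare.addsCell {l μ : YoungDiagram} (h : AddsSquare l μ) :
    AddsCell l.rowLens μ.rowLens := by
  obtain ⟨⟨k, q⟩, hc, hμ⟩ := h
  have hmem : ∀ i p, p < μ.rowLen i ↔ (i = k ∧ p = q) ∨ p < l.rowLen i := fun i p => by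
    rw [← YoungDiagram.mem_iff_lt_rowLen, ← YoungDiagram.mem_iff_lt_rowLen,
      ← YoungDiagram.mem_cells, ← YoungDiagram.mem_cells, hμ, Finset.mem_insert, Prod.mk.injEq]
  rw [YoungDiagram.mem_cells, YoungDiagram.mem_iff_lt_rowLen] at hc
  refine addsCell_of_getD l.pos_of_mem_rowLens μ.pos_of_mem_rowLens μ.rowLens_isChain
    (k := k) fun i => ?_
  rw [YoungDiagram.getD_rowLens, YoungDiagram.getD_rowLens]
  split_ifs with hi
  · subst hi
    -- Testing these four columns forces the new square to be at the end of row i and to lengthen it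
    -- by exactly one.
    have h1 := hmem i q
    have h2 := hmem i (l.rowLen i)
    have h3 := hmem i (μ.rowLen i)
    have h4 := hmem i (l.rowLen i + 1)
    omega
  · have h2 := hmem i (l.rowLen i)
    have h3 := hmem i (μ.rowLen i)
    omega

/-! ### Arcs of set partitions -/

/-- `(i, j)` is an arc of `P`: `i < j` are consecutive elements of a block. -/
def IsArc {n : ℕ} (P : SetPartition n) (i j : ℕ) : Prop :=
  i ∈ P.part j ∧ i < j ∧ ∀ k ∈ P.part j, k < j → k ≤ i

section
variable {n : ℕ} {P Q : SetPartition n} {i j k : ℕ}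

theorem mem_Icc_of_mem_part (h : i ∈ P.part j) : i ∈ Finset.Icc 1 n ∧ j ∈ Finset.Icc 1 n :=
  ⟨P.part_subset j h, P.part_nonempty.1 ⟨i, h⟩⟩

theorem part_eq_part_of_mem (h : i ∈ P.part j) : P.part i = P.part j :=
  (P.mem_part_iff_part_eq_part (mem_Icc_of_mem_part h).1 (mem_Icc_of_mem_part h).2).1 h

theorem mem_part_comm : i ∈ P.part j ↔ j ∈ P.part i := by
  suffices h : ∀ i j, i ∈ P.part j → j ∈ P.part i from ⟨h i j, h j i⟩
  intro i j h
  rw [part_eq_part_of_mem h]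
  exact P.mem_part (mem_Icc_of_mem_part h).2

theorem IsArc.one_le (h : IsArc P i j) : 1 ≤ i :=
  (Finset.mem_Icc.1 (mem_Icc_of_mem_part h.1).1).1

theorem IsArc.le (h : IsArc P i j) : j ≤ n :=
  (Finset.mem_Icc.1 (mem_Icc_of_mem_part h.1).2).2

theorem IsArc.left_unique (h : IsArc P i j) (h' : IsArc P k j) : i = k :=
  le_antisymm (h'.2.2 i h.1 h.2.1) (h.2.2 k h'.1 h'.2.1)

theorem IsArc.right_unique (h : IsArc P i j) (h' : IsArc P i k) : j = k := by
  have hp : P.part j = P.part k := by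
    rw [← part_eq_part_of_mem h.1, part_eq_part_of_mem h'.1]
  rcases lt_trichotomy j k with hjk | hjk | hjk
  · have := h'.2.2 j (hp ▸ P.mem_part (mem_Icc_of_mem_part h.1).2) hjk
    have := h.2.1
    omega
  · exact hjk
  · have := h.2.2 k (hp ▸ P.mem_part (mem_Icc_of_mem_part h'.1).2) hjk
    have := h'.2.1
    omega

theorem exists_isArc_right :
    ((P.part j).filter fun k => j < k).Nonempty ↔ ∃ k, IsArc P j k := by
  constructor
  · intro h
    have hm := Finset.min'_mem _ h
    obtain ⟨h1, h2⟩ := Finset.mem_filter.1 hm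
    refine ⟨_, mem_part_comm.1 h1, h2, fun i hi hik => ?_⟩
    by_contra hij
    rw [part_eq_part_of_mem h1] at hi
    exact absurd hik (not_lt.2 (Finset.min'_le _ i (Finset.mem_filter.2 ⟨hi, not_le.1 hij⟩)))
  · rintro ⟨k, hk⟩
    exact ⟨k, Finset.mem_filter.2 ⟨mem_part_comm.1 hk.1, hk.2.1⟩⟩

theorem exists_isArc_left_of_mem (h : i ∈ P.part j) (hij : i < j) : ∃ k, IsArc P k j ∧ i ≤ k := by
  have hne : ((P.part j).filter fun i => i < j).Nonempty := ⟨i, Finset.mem_filter.2 ⟨h, hij⟩⟩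
  obtain ⟨h1, h2⟩ := Finset.mem_filter.1 (Finset.max'_mem _ hne)
  exact ⟨_, ⟨h1, h2, fun k hk hkj => Finset.le_max' _ _ (Finset.mem_filter.2 ⟨hk, hkj⟩)⟩,
    Finset.le_max' _ _ (Finset.mem_filter.2 ⟨h, hij⟩)⟩

theorem deleteStep_of_isArc (h : IsArc P j k) (T : List (List ℕ)) :
    deleteStep P j T = removeEntry j T :=
  if_pos (exists_isArc_right.2 ⟨k, h⟩)

theorem deleteStep_of_not (h : ¬∃ k, IsArc P j k) (T : List (List ℕ)) :
    deleteStep P j T = T :=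
  if_neg (mt exists_isArc_right.1 h)

theorem insertStep_of_isArc (h : IsArc P i j) (T : List (List ℕ)) :
    insertStep P j T = rowInsert i T := by
  have hne : ((P.part j).filter fun i => i < j).Nonempty :=
    ⟨i, Finset.mem_filter.2 ⟨h.1, h.2.1⟩⟩
  rw [insertStep, dif_pos hne]
  congr 1
  refine le_antisymm ?_ (Finset.le_max' _ _ (Finset.mem_filter.2 ⟨h.1, h.2.1⟩))
  obtain ⟨h1, h2⟩ := Finset.mem_filter.1 (Finset.max'_mem _ hne)
  exact h.2.2 _ h1 h2

theorem insertStep_of_not (h : ¬∃ i, IsArc P i j) (T : List (List ℕ)) :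
    insertStep P j T = T := by
  refine dif_neg fun ⟨i, hi⟩ => h ?_
  obtain ⟨h1, h2⟩ := Finset.mem_filter.1 hi
  obtain ⟨k, hk, -⟩ := exists_isArc_left_of_mem h1 h2
  exact ⟨k, hk⟩

theorem setPartition_eq_of_part_eq (h : ∀ j ∈ Finset.Icc 1 n, P.part j = Q.part j) : P = Q := by
  suffices H : ∀ P Q : SetPartition n, (∀ j ∈ Finset.Icc 1 n, P.part j = Q.part j) →
      P.parts ⊆ Q.parts from
    Finpartition.ext (Finset.Subset.antisymm (H P Q h) (H Q P fun j hj => (h j hj).symm))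
  intro P Q h s hs
  obtain ⟨j, hj⟩ := P.nonempty_of_mem_parts hs
  have hjn : j ∈ Finset.Icc 1 n := P.le hs hj
  rw [← P.part_eq_of_mem hs hj, h j hjn]
  exact Q.part_mem.2 hjn

/-- The smaller elements of the block of j are reached from j by following arcs backwards. -/
theorem setPartition_eq_of_isArc_iff (h : ∀ i j, IsArc P i j ↔ IsArc Q i j) : P = Q := by
  have key : ∀ P Q : SetPartition n, (∀ i j, IsArc P i j ↔ IsArc Q i j) →
      ∀ j i, i < j → i ∈ P.part j → i ∈ Q.part j := by
    intro P Q h j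
    induction j using Nat.strong_induction_on with
    | _ j ih =>
      intro i hij hi
      obtain ⟨k, hk, hik⟩ := exists_isArc_left_of_mem hi hij
      have hk' := (h k j).1 hk
      rw [← part_eq_part_of_mem hk'.1]
      rcases hik.lt_or_eq with hlt | rfl
      · exact ih k hk.2.1 i hlt (by rwa [part_eq_part_of_mem hk.1])
      · exact Q.mem_part (mem_Icc_of_mem_part hk'.1).1
  have key2 : ∀ P Q : SetPartition n, (∀ i j, IsArc P i j ↔ IsArc Q i j) →
      ∀ j i, i ∈ P.part j → i ∈ Q.part j := by
    intro P Q h j i hi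
    rcases lt_trichotomy i j with hij | rfl | hij
    · exact key P Q h j i hij hi
    · exact Q.mem_part (mem_Icc_of_mem_part hi).1
    · exact mem_part_comm.1 (key P Q h i j hij (mem_part_comm.1 hi))
  exact setPartition_eq_of_part_eq fun j _ => Finset.Subset.antisymm (key2 P Q h j)
    (key2 Q P (fun i j => (h i j).symm) j)

end

/-! ### Set partitions with prescribed arcs -/

/-- The first element of the block of `j`, where `p` gives the previous element. -/
def blockRoot (p : ℕ → Option ℕ) (j : ℕ) : ℕ :=
  match p j with
  | none => j
  | some i => if i < j then blockRoot p i else j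
termination_by j

theorem blockRoot_of_none {p : ℕ → Option ℕ} {j : ℕ} (h : p j = none) : blockRoot p j = j := by
  rw [blockRoot, h]

theorem blockRoot_of_some {p : ℕ → Option ℕ} {i j : ℕ} (h : p j = some i) (hij : i < j) :
    blockRoot p j = blockRoot p i := by
  rw [blockRoot, h]
  simp [hij]

theorem blockRoot_le (p : ℕ → Option ℕ) (j : ℕ) : blockRoot p j ≤ j := by
  induction j using Nat.strong_induction_on with
  | _ j ih =>
    rw [blockRoot]
    split
    · exact le_rfl
    · split_ifs with h
      · exact (ih _ h).trans h.le
      · exact le_rfl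

/-- Chains of predecessors with a common root cannot branch, because p is injective; so no element
of the chain is skipped in passing from j to its predecessor. -/
theorem exists_some_of_blockRoot_eq {p : ℕ → Option ℕ} (hlt : ∀ i j, p j = some i → i < j)
    (hinj : ∀ i j k, p j = some i → p k = some i → j = k) {i j : ℕ} (hij : i < j)
    (h : blockRoot p i = blockRoot p j) : ∃ k, p j = some k ∧ i ≤ k := by
  induction j using Nat.strong_induction_on generalizing i with
  | _ j ih =>
    cases hp : p j with
    | none =>
      rw [blockRoot_of_none hp] at h
      have := blockRoot_le p i
      omega
    | some k =>
      refine ⟨k, rfl, ?_⟩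
      by_contra hki
      have hkj := hlt k j hp
      have hk : blockRoot p k = blockRoot p j := (blockRoot_of_some hp hkj).symm
      -- Descending from such an i, the predecessors stay at or above k by induction, so some
      -- element below j would also have predecessor k.
      have claim : ∀ i, k < i → i < j → blockRoot p i = blockRoot p j → False := by
        intro i
        induction i using Nat.strong_induction_on with
        | _ i ih2 =>
          intro h1 h2 h3
          obtain ⟨m, hm, hkm⟩ := ih i h2 h1 (hk.trans h3.symm)
          have hmi := hlt m i hm
          rcases hkm.lt_or_eq with hlt' | rfl
          · exact ih2 m hmi hlt' (hmi.trans h2) ((blockRoot_of_some hm hmi).symm.trans h3)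
          · have := hinj k i j hm hp; omega
      exact claim i (not_le.1 hki) hij h

/-- The blocks are the fibres of `blockRoot p` on the interval from 1 to n. -/
theorem exists_setPartition {n : ℕ} {p : ℕ → Option ℕ} (hlt : ∀ i j, p j = some i → i < j)
    (hinj : ∀ i j k, p j = some i → p k = some i → j = k)
    (hone : ∀ i j, p j = some i → 1 ≤ i) (hle : ∀ i j, p j = some i → j ≤ n) :
    ∃ P : SetPartition n, ∀ i j, IsArc P i j ↔ p j = some i := by
  classical
  let s : Setoid ℕ := Setoid.ker (blockRoot p)
  have hmem : ∀ i j, i ∈ (Finpartition.ofSetSetoid s (Finset.Icc 1 n)).part j ↔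
      i ∈ Finset.Icc 1 n ∧ j ∈ Finset.Icc 1 n ∧ blockRoot p i = blockRoot p j := by
    intro i j
    rw [Finpartition.mem_part_ofSetSetoid_iff_rel]
    constructor
    · rintro ⟨h1, h2, h3⟩; exact ⟨h2, h1, Eq.symm h3⟩
    · rintro ⟨h1, h2, h3⟩; exact ⟨h2, h1, Eq.symm h3⟩
  refine ⟨Finpartition.ofSetSetoid s (Finset.Icc 1 n), fun i j => ?_⟩
  have arc : ∀ i j, p j = some i → i ∈ (Finpartition.ofSetSetoid s (Finset.Icc 1 n)).part j := by
    intro i j h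
    have h1 := hlt i j h
    have h2 := hone i j h
    have h3 := hle i j h
    exact (hmem i j).2 ⟨Finset.mem_Icc.2 ⟨h2, by omega⟩, Finset.mem_Icc.2 ⟨by omega, h3⟩,
      (blockRoot_of_some h h1).symm⟩
  constructor
  · rintro ⟨h1, h2, h3⟩
    obtain ⟨k, hk, hik⟩ := exists_some_of_blockRoot_eq hlt hinj h2 ((hmem i j).1 h1).2.2
    rw [hk, le_antisymm hik (h3 k (arc k j hk) (hlt k j hk))]
  · intro h
    refine ⟨arc i j h, hlt i j h, fun k hk hkj => ?_⟩
    obtain ⟨m, hm, hkm⟩ := exists_some_of_blockRoot_eq hlt hinj hkj ((hmem k j).1 hk).2.2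
    rw [h] at hm
    cases hm
    exact hkm

/-! ### The Chen–Deng–Du–Stanley–Yan bijection -/

theorem eq_nil_of_forall_notMem {T : List (List ℕ)} (hT : IsTableau T)
    (h : ∀ z, z ∉ T.flatten) : T = [] := by
  cases T with
  | nil => rfl
  | cons r t =>
    obtain ⟨z, s, rfl⟩ := List.exists_cons_of_ne_nil hT.1
    exact absurd (by simp) (h z)

section
variable {n : ℕ} (P : SetPartition n) {i : ℕ}

theorem cddsyTableau_last : cddsyTableau P (2 * n) = [] := by
  rw [cddsyTableau, if_pos (by omega), show n - 2 * n / 2 = 0 by omega, cddsyRead]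

theorem cddsyTableau_odd (i : ℕ) : cddsyTableau P (2 * i + 1) =
    deleteStep P (i + 1) (cddsyTableau P (2 * i + 2)) := by
  rw [cddsyTableau, if_neg (by omega), cddsyTableau, if_pos (by omega),
    show (2 * i + 1) / 2 = i by omega, show (2 * i + 2) / 2 = i + 1 by omega]

theorem cddsyTableau_even (hi : i < n) : cddsyTableau P (2 * i) =
    insertStep P (i + 1) (cddsyTableau P (2 * i + 1)) := by
  rw [cddsyTableau_odd, cddsyTableau, if_pos (by omega), cddsyTableau, if_pos (by omega),
    show n - 2 * i / 2 = (n - (i + 1)) + 1 by omega, cddsyRead,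
    show (2 * i + 2) / 2 = i + 1 by omega, show n - (n - (i + 1)) = i + 1 by omega]

variable {P}

/-- If i + 1 is a left endpoint, it is the largest entry of T₂ᵢ₊₂, so deleting it undoes an
`AppendsEntry`. -/
theorem odd_of_even (hT : IsTableau (cddsyTableau P (2 * i + 2)))
    (hm : ∀ z, z ∈ (cddsyTableau P (2 * i + 2)).flatten ↔ z ≤ i + 1 ∧ ∃ k > i + 1, IsArc P z k) :
    IsTableau (cddsyTableau P (2 * i + 1)) ∧
    (∀ z, z ∈ (cddsyTableau P (2 * i + 1)).flatten ↔ z ≤ i ∧ ∃ k > i + 1, IsArc P z k) ∧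
    ((¬∃ k, IsArc P (i + 1) k) ∧ cddsyTableau P (2 * i + 2) = cddsyTableau P (2 * i + 1) ∨
      (∃ k, IsArc P (i + 1) k) ∧
        AppendsEntry (i + 1) (cddsyTableau P (2 * i + 1)) (cddsyTableau P (2 * i + 2))) := by
  by_cases h : ∃ k, IsArc P (i + 1) k
  · obtain ⟨k, hk⟩ := h
    obtain ⟨S, h1, h2, h3⟩ := exists_appendsEntry_of_mem hT (fun z hz => ((hm z).1 hz).1)
      ((hm (i + 1)).2 ⟨le_rfl, k, hk.2.1, hk⟩)
    have e : cddsyTableau P (2 * i + 1) = S := by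
      rw [cddsyTableau_odd, deleteStep_of_isArc hk, h1.removeEntry_eq h2 h3]
    rw [e]
    refine ⟨h2, fun z => ?_, Or.inr ⟨⟨k, hk⟩, h1⟩⟩
    have e1 := h1.mem_iff z
    rw [hm z] at e1
    constructor
    · intro hz
      have : z ≠ i + 1 := fun e => h3 (e ▸ hz)
      obtain ⟨h4, h5⟩ := e1.2 (Or.inr hz)
      exact ⟨by omega, h5⟩
    · rintro ⟨h4, h5⟩
      exact (e1.1 ⟨by omega, h5⟩).resolve_left (by omega)
  · have e : cddsyTableau P (2 * i + 1) = cddsyTableau P (2 * i + 2) := by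
      rw [cddsyTableau_odd, deleteStep_of_not h]
    rw [e]
    refine ⟨hT, fun z => ?_, Or.inl ⟨h, rfl⟩⟩
    rw [hm z]
    constructor
    · rintro ⟨h4, k, h5, h6⟩
      have : z ≠ i + 1 := fun e => h ⟨k, e ▸ h6⟩
      exact ⟨by omega, k, h5, h6⟩
    · rintro ⟨h4, h5⟩
      exact ⟨by omega, h5⟩

theorem even_of_odd (hi : i < n) (hT : IsTableau (cddsyTableau P (2 * i + 1)))
    (hm : ∀ z, z ∈ (cddsyTableau P (2 * i + 1)).flatten ↔ z ≤ i ∧ ∃ k > i + 1, IsArc P z k) :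
    IsTableau (cddsyTableau P (2 * i)) ∧
    (∀ z, z ∈ (cddsyTableau P (2 * i)).flatten ↔ z ≤ i ∧ ∃ k > i, IsArc P z k) ∧
    ((¬∃ x, IsArc P x (i + 1)) ∧ cddsyTableau P (2 * i) = cddsyTableau P (2 * i + 1) ∨
      ∃ x, IsArc P x (i + 1) ∧
        cddsyTableau P (2 * i) = rowInsert x (cddsyTableau P (2 * i + 1))) := by
  by_cases h : ∃ x, IsArc P x (i + 1)
  · obtain ⟨x, hx⟩ := h
    have e : cddsyTableau P (2 * i) = rowInsert x (cddsyTableau P (2 * i + 1)) := by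
      rw [cddsyTableau_even P hi, insertStep_of_isArc hx]
    have hI := inserts_rowInsert x (cddsyTableau P (2 * i + 1))
    -- The arc from x ends in i + 1, whereas the entries of T₂ᵢ₊₁ have arcs ending later.
    have hxS : x ∉ (cddsyTableau P (2 * i + 1)).flatten := by
      rw [hm x]
      rintro ⟨-, k, hk, hk'⟩
      have := hk'.right_unique hx
      omega
    rw [e]
    refine ⟨hI.isTableau hT hxS, fun z => ?_, Or.inr ⟨x, hx, rfl⟩⟩
    rw [hI.mem_iff, hm z]
    constructor
    · rintro (rfl | ⟨h1, k, h2, h3⟩)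
      · exact ⟨Nat.lt_succ_iff.1 hx.2.1, i + 1, by omega, hx⟩
      · exact ⟨h1, k, by omega, h3⟩
    · rintro ⟨h1, k, h2, h3⟩
      rcases (show i + 1 ≤ k from h2).eq_or_lt with rfl | h4
      · exact Or.inl (h3.left_unique hx)
      · exact Or.inr ⟨h1, k, h4, h3⟩
  · have e : cddsyTableau P (2 * i) = cddsyTableau P (2 * i + 1) := by
      rw [cddsyTableau_even P hi, insertStep_of_not h]
    rw [e]
    refine ⟨hT, fun z => ?_, Or.inl ⟨h, rfl⟩⟩
    rw [hm z]
    constructor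
    · rintro ⟨h1, k, h2, h3⟩
      exact ⟨h1, k, by omega, h3⟩
    · rintro ⟨h1, k, h2, h3⟩
      rcases (show i + 1 ≤ k from h2).eq_or_lt with rfl | h4
      · exact absurd ⟨z, h3⟩ h
      · exact ⟨h1, k, h4, h3⟩

variable (P)

/-- The invariant of the procedure, by descending induction from T₂ₙ = ∅: the entries are the left
endpoints of the arcs that pass over the gap between i and i + 1. -/
theorem cddsyTableau_even_spec (hi : i ≤ n) : IsTableau (cddsyTableau P (2 * i)) ∧
    ∀ z, z ∈ (cddsyTableau P (2 * i)).flatten ↔ z ≤ i ∧ ∃ k > i, IsArc P z k := by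
  induction hi using Nat.decreasingInduction with
  | self =>
    rw [cddsyTableau_last]
    refine ⟨trivial, fun z => ⟨by simp, ?_⟩⟩
    rintro ⟨-, k, hk, h⟩
    have := h.le
    omega
  | of_succ i hi ih =>
    obtain ⟨h1, h2, -⟩ := odd_of_even ih.1 ih.2
    obtain ⟨h3, h4, -⟩ := even_of_odd hi h1 h2
    exact ⟨h3, h4⟩

theorem cddsyTableau_odd_spec (hi : i < n) : IsTableau (cddsyTableau P (2 * i + 1)) ∧
    (∀ z, z ∈ (cddsyTableau P (2 * i + 1)).flatten ↔ z ≤ i ∧ ∃ k > i + 1, IsArc P z k) ∧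
    ((¬∃ k, IsArc P (i + 1) k) ∧ cddsyTableau P (2 * i + 2) = cddsyTableau P (2 * i + 1) ∨
      (∃ k, IsArc P (i + 1) k) ∧
        AppendsEntry (i + 1) (cddsyTableau P (2 * i + 1)) (cddsyTableau P (2 * i + 2))) :=
  have h := cddsyTableau_even_spec P (i := i + 1) hi
  odd_of_even h.1 h.2

theorem cddsyTableau_even_step (hi : i < n) :
    (¬∃ x, IsArc P x (i + 1)) ∧ cddsyTableau P (2 * i) = cddsyTableau P (2 * i + 1) ∨
      ∃ x, IsArc P x (i + 1) ∧
        cddsyTableau P (2 * i) = rowInsert x (cddsyTableau P (2 * i + 1)) :=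
  have h := cddsyTableau_odd_spec P hi
  (even_of_odd hi h.1 h.2.1).2.2

theorem isTableau_cddsyTableau {m : ℕ} (hm : m ≤ 2 * n) : IsTableau (cddsyTableau P m) := by
  rcases Nat.even_or_odd' m with ⟨i, rfl | rfl⟩
  · exact (cddsyTableau_even_spec P (by omega)).1
  · exact (cddsyTableau_odd_spec P (by omega)).1

theorem cddsyTableau_zero : cddsyTableau P 0 = [] := by
  have h := cddsyTableau_even_spec P (Nat.zero_le n)
  refine eq_nil_of_forall_notMem h.1 fun z hz => ?_
  obtain ⟨h1, k, -, h2⟩ := (h.2 z).1 hz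
  have := h2.one_le
  omega

/-- The shape of the `m`-th tableau of a set partition. -/
def cddsyShape (m : Fin (2 * n + 1)) : YoungDiagram :=
  .ofRowLens (rowLengths (cddsyTableau P m))
    (isTableau_cddsyTableau P (Nat.lt_succ_iff.1 m.2)).isChain.sortedGE

theorem rowLens_cddsyShape (m : Fin (2 * n + 1)) :
    (cddsyShape P m).rowLens = rowLengths (cddsyTableau P m) :=
  YoungDiagram.rowLens_ofRowLens_eq_self
    (isTableau_cddsyTableau P (Nat.lt_succ_iff.1 m.2)).pos

/-- The Chen–Deng–Du–Stanley–Yan map. -/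
def cddsyMap : VacillatingTableau n ⊥ where
  shape := cddsyShape P
  shape_zero := YoungDiagram.rowLens_injective <| by
    rw [rowLens_cddsyShape, YoungDiagram.rowLens_bot, Fin.val_zero, cddsyTableau_zero,
      rowLengths_nil]
  shape_last := YoungDiagram.rowLens_injective <| by
    rw [rowLens_cddsyShape, YoungDiagram.rowLens_bot, Fin.val_last, cddsyTableau_last,
      rowLengths_nil]
  odd_step i := by
    rcases cddsyTableau_even_step P i.2 with ⟨-, h⟩ | ⟨x, -, h⟩
    · refine Or.inl (YoungDiagram.rowLens_injective ?_)
      rw [rowLens_cddsyShape, rowLens_cddsyShape]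
      exact congrArg rowLengths h.symm
    · refine Or.inr (addsSquare_of_addsCell ?_)
      rw [rowLens_cddsyShape, rowLens_cddsyShape]
      simp only [h]
      exact (inserts_rowInsert x _).addsCell
  even_step i := by
    rcases (cddsyTableau_odd_spec P i.2).2.2 with ⟨-, h⟩ | ⟨-, h⟩
    · refine Or.inl (YoungDiagram.rowLens_injective ?_)
      rw [rowLens_cddsyShape, rowLens_cddsyShape]
      exact congrArg rowLengths h
    · refine Or.inr (addsSquare_of_addsCell ?_)
      rw [rowLens_cddsyShape, rowLens_cddsyShape]
      exact h.addsCell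

theorem isCDDSYMap_cddsyMap : IsCDDSYMap (cddsyMap (n := n)) :=
  fun P m => rowLens_cddsyShape P m

end

/-! ### Injectivity -/

theorem cddsyMap_injective (n : ℕ) : Function.Injective (cddsyMap (n := n)) := by
  intro P Q h
  have hsh : ∀ m ≤ 2 * n, rowLengths (cddsyTableau P m) = rowLengths (cddsyTableau Q m) := by
    intro m hm
    have e : cddsyShape P ⟨m, by omega⟩ = cddsyShape Q ⟨m, by omega⟩ :=
      congrFun (congrArg VacillatingTableau.shape h) _
    simpa only [rowLens_cddsyShape] using congrArg YoungDiagram.rowLens e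
  -- Induction upwards from T₀ = ∅, against the direction of the procedure: the shapes determine the
  -- next two tableaux and the arc ending in i + 1.
  have key : ∀ i ≤ n, cddsyTableau P (2 * i) = cddsyTableau Q (2 * i) ∧
      ∀ j ≤ i, ∀ z, IsArc P z j ↔ IsArc Q z j := by
    intro i
    induction i with
    | zero =>
      refine fun _ => ⟨by rw [Nat.mul_zero, cddsyTableau_zero, cddsyTableau_zero], ?_⟩
      intro j hj z
      constructor <;> intro h <;> have := h.2.1 <;> omega
    | succ i ih =>
      intro hi
      obtain ⟨h1, h2⟩ := ih (by omega)
      have hl := hsh (2 * i + 1) (by omega)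
      have hodd : cddsyTableau P (2 * i + 1) = cddsyTableau Q (2 * i + 1) ∧
          ∀ z, IsArc P z (i + 1) ↔ IsArc Q z (i + 1) := by
        rcases cddsyTableau_even_step P (i := i) (by omega) with ⟨e1, e2⟩ | ⟨x, e1, e2⟩ <;>
          rcases cddsyTableau_even_step Q (i := i) (by omega) with ⟨e3, e4⟩ | ⟨y, e3, e4⟩
        · exact ⟨by rw [← e2, ← e4, h1], fun z => iff_of_false (fun h => e1 ⟨z, h⟩)
            fun h => e3 ⟨z, h⟩⟩
        · refine absurd ?_ (inserts_rowInsert y (cddsyTableau Q (2 * i + 1))).addsCell.ne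
          rw [← e4, ← h1, e2, hl]
        · refine absurd ?_ (inserts_rowInsert x (cddsyTableau P (2 * i + 1))).addsCell.ne
          rw [← e2, h1, e4, hl]
        · obtain ⟨rfl, e⟩ := rowInsert_inj (isTableau_cddsyTableau P (by omega))
            (isTableau_cddsyTableau Q (by omega)) hl (e2.symm.trans (h1.trans e4))
          refine ⟨e, fun z => ⟨fun h => ?_, fun h => ?_⟩⟩
          · rwa [h.left_unique e1]
          · rwa [h.left_unique e3]
      refine ⟨?_, fun j hj => ?_⟩
      · have hl2 := hsh (2 * i + 2) (by omega)
        change cddsyTableau P (2 * i + 2) = cddsyTableau Q (2 * i + 2)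
        rcases (cddsyTableau_odd_spec P (i := i) (by omega)).2.2 with ⟨-, e2⟩ | ⟨-, e2⟩ <;>
          rcases (cddsyTableau_odd_spec Q (i := i) (by omega)).2.2 with ⟨-, e4⟩ | ⟨-, e4⟩
        · rw [e2, e4, hodd.1]
        · refine absurd ?_ e4.addsCell.ne
          rw [← hl, ← hl2, e2]
        · refine absurd ?_ e2.addsCell.ne
          rw [hl, hl2, e4]
        · rw [← hodd.1] at e4
          exact e2.unique e4 hl2
      · rcases hj.eq_or_lt with rfl | hj
        · exact hodd.2
        · exact h2 j (by omega)
  refine setPartition_eq_of_isArc_iff fun i j => ?_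
  by_cases hj : j ≤ n
  · exact (key n le_rfl).2 j hj i
  · exact iff_of_false (fun h => hj h.le) fun h => hj h.le

/-! ### The inverse map -/

/-- The `m`-th partition of a vacillating tableau, which is `∅` if `m` is too large. -/
def VacillatingTableau.shapeAt {n : ℕ} {l : YoungDiagram} (V : VacillatingTableau n l) (m : ℕ) :
    YoungDiagram :=
  if h : m < 2 * n + 1 then V.shape ⟨m, h⟩ else ⊥

section
variable {n : ℕ} {l : YoungDiagram} (V : VacillatingTableau n l)

theorem VacillatingTableau.shapeAt_of_lt {m : ℕ} (h : m < 2 * n + 1) :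
    V.shapeAt m = V.shape ⟨m, h⟩ := dif_pos h

theorem VacillatingTableau.shapeAt_zero : V.shapeAt 0 = ⊥ := by
  rw [V.shapeAt_of_lt (by omega)]
  exact V.shape_zero

theorem VacillatingTableau.shapeAt_last : V.shapeAt (2 * n) = l := by
  rw [V.shapeAt_of_lt (by omega)]
  exact V.shape_last

theorem VacillatingTableau.shapeAt_odd {i : ℕ} (hi : i < n) :
    V.shapeAt (2 * i + 1) = V.shapeAt (2 * i) ∨
      AddsSquare (V.shapeAt (2 * i + 1)) (V.shapeAt (2 * i)) := by
  rw [V.shapeAt_of_lt (by omega), V.shapeAt_of_lt (by omega)]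
  exact V.odd_step ⟨i, hi⟩

theorem VacillatingTableau.shapeAt_even {i : ℕ} (hi : i < n) :
    V.shapeAt (2 * i + 2) = V.shapeAt (2 * i + 1) ∨
      AddsSquare (V.shapeAt (2 * i + 1)) (V.shapeAt (2 * i + 2)) := by
  rw [V.shapeAt_of_lt (by omega), V.shapeAt_of_lt (by omega)]
  exact V.even_step ⟨i, hi⟩

end

/-- `S` and `U` are possible tableaux `T₂ᵢ₊₁` and `T₂ᵢ₊₂` following `T₂ᵢ = T`, of shapes `μ`
and `ν`, where `p` is the left endpoint of the arc ending in `i + 1`, if there is one. -/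
structure ReverseStep (i : ℕ) (μ ν : YoungDiagram) (p : Option ℕ) (T S U : List (List ℕ)) :
    Prop where
  isTableau_mid : IsTableau S
  isTableau_right : IsTableau U
  rowLengths_mid : rowLengths S = μ.rowLens
  rowLengths_right : rowLengths U = ν.rowLens
  left : p = none ∧ T = S ∨ ∃ x, p = some x ∧ Inserts x S T ∧ x ∉ S.flatten
  right : U = S ∨ AppendsEntry (i + 1) S U

theorem ReverseStep.mem_left_iff {i : ℕ} {μ ν : YoungDiagram} {p : Option ℕ}
    {T S U : List (List ℕ)} (h : ReverseStep i μ ν p T S U) (z : ℕ) :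
    z ∈ T.flatten ↔ p = some z ∨ z ∈ S.flatten := by
  rcases h.left with ⟨rfl, rfl⟩ | ⟨x, rfl, h, -⟩
  · simp
  · rw [h.mem_iff, Option.some_inj, eq_comm]

theorem ReverseStep.notMem {i : ℕ} {μ ν : YoungDiagram} {p : Option ℕ}
    {T S U : List (List ℕ)} (h : ReverseStep i μ ν p T S U) {z : ℕ} (hz : p = some z) :
    z ∉ S.flatten := by
  rcases h.left with ⟨rfl, rfl⟩ | ⟨x, rfl, -, h⟩
  · simp at hz
  · cases hz; exact h

theorem ReverseStep.mem_right {i : ℕ} {μ ν : YoungDiagram} {p : Option ℕ}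
    {T S U : List (List ℕ)} (h : ReverseStep i μ ν p T S U) {z : ℕ} (hz : z ∈ S.flatten) :
    z ∈ U.flatten := by
  rcases h.right with rfl | h
  · exact hz
  · exact (h.mem_iff z).2 (Or.inr hz)

theorem ReverseStep.eq_or_mem {i : ℕ} {μ ν : YoungDiagram} {p : Option ℕ}
    {T S U : List (List ℕ)} (h : ReverseStep i μ ν p T S U) {z : ℕ} (hz : z ∈ U.flatten) :
    z = i + 1 ∨ z ∈ S.flatten := by
  rcases h.right with rfl | h
  · exact Or.inr hz
  · exact (h.mem_iff z).1 hz

theorem exists_reverseStep {i : ℕ} {l μ ν : YoungDiagram} {T : List (List ℕ)}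
    (hT : IsTableau T) (hle : ∀ z ∈ T.flatten, z ≤ i) (hl : rowLengths T = l.rowLens)
    (h1 : μ = l ∨ AddsSquare μ l) (h2 : ν = μ ∨ AddsSquare μ ν) :
    ∃ p S U, ReverseStep i μ ν p T S U := by
  obtain ⟨p, S, hS, hSl, hp⟩ : ∃ p S, IsTableau S ∧ rowLengths S = μ.rowLens ∧
      (p = none ∧ T = S ∨ ∃ x, p = some x ∧ Inserts x S T ∧ x ∉ S.flatten) := by
    rcases h1 with rfl | h1
    · exact ⟨none, T, hT, hl, Or.inl ⟨rfl, rfl⟩⟩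
    · have h := h1.addsCell
      rw [← hl] at h
      obtain ⟨x, S, e1, e2, e3, e4⟩ := exists_inserts h μ.rowLens_isChain μ.pos_of_mem_rowLens hT
      exact ⟨some x, S, e2, e4, Or.inr ⟨x, rfl, e1, e3⟩⟩
  have hSle : ∀ z ∈ S.flatten, z < i + 1 := by
    intro z hz
    rcases hp with ⟨-, rfl⟩ | ⟨x, -, h, -⟩
    · exact Nat.lt_succ_iff.2 (hle z hz)
    · exact Nat.lt_succ_iff.2 (hle z ((h.mem_iff z).2 (Or.inr hz)))
  rcases h2 with rfl | h2
  · exact ⟨p, S, S, hS, hS, hSl, hSl, hp, Or.inl rfl⟩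
  · have h := h2.addsCell
    rw [← hSl] at h
    obtain ⟨U, hU, hUl⟩ := exists_appendsEntry (i + 1) h
    exact ⟨p, S, U, hS, hU.isTableau hS hSle (by rw [hUl]; exact ν.rowLens_isChain), hSl, hUl, hp,
      Or.inr hU⟩

/-- Iterates the single reverse step along the shapes of V. Here `T i`, `S i` stand for T₂ᵢ, T₂ᵢ₊₁,
and `p i` is the number ejected at step i. -/
theorem exists_reverseSteps {n : ℕ} (V : VacillatingTableau n ⊥) :
    ∃ (T S : ℕ → List (List ℕ)) (p : ℕ → Option ℕ), T 0 = [] ∧ T n = [] ∧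
      (∀ j, n ≤ j → p j = none) ∧ (∀ i ≤ n, ∀ z ∈ (T i).flatten, 1 ≤ z ∧ z ≤ i) ∧
      ∀ i < n, ReverseStep i (V.shapeAt (2 * i + 1)) (V.shapeAt (2 * (i + 1))) (p i)
        (T i) (S i) (T (i + 1)) := by
  -- The hypotheses stand behind the existential, with junk values when they fail, so that `choose`
  -- gives total functions to iterate.
  have step : ∀ (i : ℕ) (T : List (List ℕ)), ∃ (p : Option ℕ) (S U : List (List ℕ)),
      i < n → IsTableau T → (∀ z ∈ T.flatten, z ≤ i) →
      rowLengths T = (V.shapeAt (2 * i)).rowLens →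
      ReverseStep i (V.shapeAt (2 * i + 1)) (V.shapeAt (2 * (i + 1))) p T S U := by
    intro i T
    by_cases h : i < n ∧ IsTableau T ∧ (∀ z ∈ T.flatten, z ≤ i) ∧
      rowLengths T = (V.shapeAt (2 * i)).rowLens
    · obtain ⟨p, S, U, hR⟩ := exists_reverseStep h.2.1 h.2.2.1 h.2.2.2 (V.shapeAt_odd h.1)
        (V.shapeAt_even h.1)
      exact ⟨p, S, U, fun _ _ _ _ => hR⟩
    · exact ⟨none, [], [], fun h1 h2 h3 h4 => absurd ⟨h1, h2, h3, h4⟩ h⟩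
  choose p S U hR using step
  let T : ℕ → List (List ℕ) := fun i => Nat.rec [] (fun i T => U i T) i
  have hT : ∀ i ≤ n, IsTableau (T i) ∧ (∀ z ∈ (T i).flatten, 1 ≤ z ∧ z ≤ i) ∧
      rowLengths (T i) = (V.shapeAt (2 * i)).rowLens := by
    intro i
    induction i with
    | zero =>
      refine fun _ => ⟨trivial, by simp [T], ?_⟩
      rw [Nat.mul_zero, V.shapeAt_zero, YoungDiagram.rowLens_bot]
      rfl
    | succ i ih =>
      intro hi
      obtain ⟨h1, h2, h3⟩ := ih (by omega)
      have h := hR i (T i) (by omega) h1 (fun z hz => (h2 z hz).2) h3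
      refine ⟨h.isTableau_right, fun z hz => ?_, h.rowLengths_right⟩
      rcases h.eq_or_mem hz with rfl | hz
      · omega
      · have := h2 z ((h.mem_left_iff z).2 (Or.inr hz))
        omega
  refine ⟨T, fun i => S i (T i), fun i => if i < n then p i (T i) else none, rfl, ?_,
    fun j hj => if_neg (by omega), fun i hi => (hT i hi).2.1, fun i hi => ?_⟩
  · have h := (hT n le_rfl).2.2
    rw [V.shapeAt_last, YoungDiagram.rowLens_bot] at h
    exact rows_of_tail_lengths_nil h.symm
  · obtain ⟨h1, h2, h3⟩ := hT i hi.le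
    simp only [if_pos hi]
    exact hR i (T i) hi h1 (fun z hz => (h2 z hz).2) h3

theorem cddsyMap_surjective (n : ℕ) : Function.Surjective (cddsyMap (n := n)) := by
  intro V
  obtain ⟨T, S, q, hT0, hTn, hq, hle, hR⟩ := exists_reverseSteps V
  -- The only number that can enter at step m is m + 1, so an entry z ≤ i of a later tableau was
  -- already present at time i.
  have down : ∀ i j z, z ≤ i → i ≤ j → j ≤ n → z ∈ (T j).flatten → z ∈ (T i).flatten := by
    intro i j z hz hij
    induction hij with
    | refl => exact fun _ h => h
    | @step j hij ih =>
      intro hj h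
      have hij : i ≤ j := hij
      refine ih (by omega) (((hR j hj).mem_left_iff z).2 (Or.inr ?_))
      exact ((hR j hj).eq_or_mem h).resolve_left (by omega)
  have hqlt : ∀ i z, q i = some z → i < n := by
    intro i z h
    by_contra hi
    rw [hq i (by omega)] at h
    simp at h
  have hqmem : ∀ i z, q i = some z → z ∈ (T i).flatten := fun i z h =>
    ((hR i (hqlt i z h)).mem_left_iff z).2 (Or.inl h)
  have exit : ∀ i ≤ n, ∀ z ∈ (T i).flatten, ∃ k, q k = some z := by
    intro i hi
    induction hi using Nat.decreasingInduction with
    | self => simp [hTn]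
    | of_succ i hi ih =>
      intro z hz
      rcases ((hR i hi).mem_left_iff z).1 hz with h | h
      · exact ⟨i, h⟩
      · exact ih z ((hR i hi).mem_right h)
  -- A number ejected at step i is at most i and cannot enter again, so it is not there to be
  -- ejected later.
  have hinj' : ∀ i j z, q i = some z → q j = some z → ¬i < j := by
    intro i j z hi hj hij
    have hin := hqlt i z hi
    have hjn := hqlt j z hj
    have hz := hle i hin.le z (hqmem i z hi)
    have h := down (i + 1) j z (by omega) hij hjn.le (hqmem j z hj)
    exact (hR i hin).notMem hi (((hR i hin).eq_or_mem h).resolve_left (by omega))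
  have hinj : ∀ i j z, q i = some z → q j = some z → i = j := fun i j z hi hj =>
    le_antisymm (not_lt.1 (hinj' j i z hj hi)) (not_lt.1 (hinj' i j z hi hj))
  -- The index shifts by one: step i ejects the left endpoint of the arc ending in i + 1.
  obtain ⟨P, hP⟩ := exists_setPartition (n := n) (p := fun j => if j = 0 then none else q (j - 1))
    (by
      intro i j h
      split_ifs at h with hj
      have := hle _ (hqlt _ _ h).le _ (hqmem _ _ h)
      omega)
    (by
      intro i j k h h'
      split_ifs at h h'
      have := hinj _ _ _ h h'
      omega)
    (by
      intro i j h
      split_ifs at h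
      exact (hle _ (hqlt _ _ h).le _ (hqmem _ _ h)).1)
    (by
      intro i j h
      split_ifs at h
      have := hqlt _ _ h
      omega)
  have hP' : ∀ z i, IsArc P z (i + 1) ↔ q i = some z := fun z i => by
    rw [hP]; simp
  have odd : ∀ i < n, cddsyTableau P (2 * (i + 1)) = T (i + 1) →
      cddsyTableau P (2 * i + 1) = S i := by
    intro i hi h
    have h : cddsyTableau P (2 * i + 2) = T (i + 1) := h
    have hS : i + 1 ∉ (S i).flatten := fun hS => by
      have := hle i hi.le _ (((hR i hi).mem_left_iff _).2 (Or.inr hS))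
      omega
    rw [cddsyTableau_odd, h]
    -- The number i + 1 is a left endpoint exactly when it entered at step i: an entry must leave
    -- through some arc, and an ejected number must have entered.
    by_cases ha : ∃ k, IsArc P (i + 1) k
    · obtain ⟨k, hk⟩ := ha
      rw [deleteStep_of_isArc hk]
      rcases (hR i hi).right with e | e
      · obtain ⟨k, rfl⟩ : ∃ m, k = m + 1 := ⟨k - 1, by have := hk.2.1; omega⟩
        have hk1 := (hP' _ _).1 hk
        have := hk.2.1
        have := down (i + 1) k (i + 1) le_rfl (by omega) (hqlt _ _ hk1).le (hqmem _ _ hk1)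
        rw [e] at this
        exact absurd this hS
      · exact e.removeEntry_eq (hR i hi).isTableau_mid hS
    · rw [deleteStep_of_not ha]
      refine (hR i hi).right.resolve_right fun e => ha ?_
      obtain ⟨k, hk⟩ := exit (i + 1) hi (i + 1) ((e.mem_iff _).2 (Or.inl rfl))
      exact ⟨k + 1, (hP' _ _).2 hk⟩
  have even : ∀ i ≤ n, cddsyTableau P (2 * i) = T i := by
    intro i hi
    induction hi using Nat.decreasingInduction with
    | self => rw [hTn, cddsyTableau_last]
    | of_succ i hi ih =>
      rw [cddsyTableau_even P hi, odd i hi ih]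
      rcases (hR i hi).left with ⟨h1, h2⟩ | ⟨x, h1, h2, -⟩
      · rw [insertStep_of_not, h2]
        rintro ⟨x, hx⟩
        rw [hP', h1] at hx
        simp at hx
      · rw [insertStep_of_isArc ((hP' _ _).2 h1), h2.rowInsert_eq]
  refine ⟨P, VacillatingTableau.ext (funext fun m => YoungDiagram.rowLens_injective ?_)⟩
  change (cddsyShape P m).rowLens = _
  rw [rowLens_cddsyShape, ← V.shapeAt_of_lt m.2]
  rcases Nat.even_or_odd' m with ⟨i, h | h⟩
  · rw [h, even i (by omega)]
    cases i with
    | zero => rw [hT0, Nat.mul_zero, V.shapeAt_zero, YoungDiagram.rowLens_bot, rowLengths_nil]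
    | succ i => exact (hR i (by omega)).rowLengths_right
  · rw [h, odd i (by omega) (even _ (by omega))]
    exact (hR i (by omega)).rowLengths_mid

/-! ### Fixed points of conjugation -/

theorem YoungDiagram.zero_mem_of_mem {μ : YoungDiagram} {c : ℕ × ℕ} (h : c ∈ μ.cells) :
    (0, 0) ∈ μ.cells :=
  μ.isLowerSet (show (0, 0) ≤ c from ⟨Nat.zero_le _, Nat.zero_le _⟩) h

theorem oneSquare_ne_bot : oneSquare ≠ ⊥ := fun h => by
  have := congrArg YoungDiagram.cells h
  simp [oneSquare] at this

theorem addsSquare_bot_oneSquare : AddsSquare ⊥ oneSquare :=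
  ⟨(0, 0), by simp, by simp [oneSquare]⟩

theorem not_addsSquare_bot (μ : YoungDiagram) : ¬AddsSquare μ ⊥ := by
  rintro ⟨c, -, h⟩
  have : c ∈ (⊥ : YoungDiagram).cells := by rw [h]; simp
  simp at this

theorem AddsSquare.eq_bot {μ : YoungDiagram} (h : AddsSquare μ oneSquare) : μ = ⊥ := by
  obtain ⟨c, hc, h⟩ := h
  have h1 : c ∈ oneSquare.cells := by rw [h]; simp
  have hc0 : c = (0, 0) := by simpa [oneSquare] using h1
  subst hc0
  have h2 : ∀ x, x ∉ μ.cells := fun x hx => hc (YoungDiagram.zero_mem_of_mem hx)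
  ext x
  simpa using h2 x

/-- If l were (1), the added square would have to equal its own reflection, hence be a diagonal
square (a, a) with a > 0, and then (0, a) would be a third square. -/
theorem AddsSquare.eq_oneSquare {l μ : YoungDiagram} (h : AddsSquare l μ)
    (hl : l = ⊥ ∨ l = oneSquare) (hμ : μ.transpose = μ) : μ = oneSquare := by
  obtain ⟨c, hc, h⟩ := h
  have hcμ : c ∈ μ.cells := by rw [h]; simp
  have h0 := YoungDiagram.zero_mem_of_mem hcμ
  rcases hl with rfl | rfl
  · rw [h] at h0
    have hc0 : (0, 0) = c := by simpa using h0
    subst hc0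
    ext x
    rw [h]
    simp [oneSquare]
  · exfalso
    have hmem : ∀ x, x ∈ μ.cells ↔ x = c ∨ x = (0, 0) := fun x => by
      rw [h]; simp [oneSquare]
    have hc0 : c ≠ (0, 0) := by simpa [oneSquare] using hc
    obtain ⟨a, b⟩ := c
    have hs : (b, a) ∈ μ.cells := by
      rw [← hμ]
      simpa using hcμ
    have h1 : (0, b) ∈ μ.cells :=
      μ.isLowerSet (show (0, b) ≤ (a, b) from ⟨Nat.zero_le _, le_rfl⟩) hcμ
    rw [hmem] at hs h1
    simp only [Prod.mk.injEq, ne_eq] at hs h1 hc0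
    omega

theorem oneSquare_transpose : oneSquare.transpose = oneSquare := by
  ext ⟨a, b⟩
  rw [YoungDiagram.mem_cells, YoungDiagram.mem_transpose, ← YoungDiagram.mem_cells]
  simp [oneSquare, and_comm]

theorem fixedPoints_conjugateTableau (n : ℕ) :
    Function.fixedPoints (conjugateTableau (n := n)) = flatTableaux n := by
  ext V
  constructor
  · intro h
    have hc : ∀ m, (V.shapeAt m).transpose = V.shapeAt m := fun m => by
      by_cases hm : m < 2 * n + 1
      · rw [V.shapeAt_of_lt hm]
        exact congrFun (congrArg VacillatingTableau.shape h) _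
      · rw [VacillatingTableau.shapeAt, dif_neg hm, YoungDiagram.transpose_bot']
    have key : ∀ i ≤ n, V.shapeAt (2 * i) = ⊥ ∨ V.shapeAt (2 * i) = oneSquare := by
      intro i
      induction i with
      | zero => exact fun _ => Or.inl V.shapeAt_zero
      | succ i ih =>
        intro hi
        have h0 := ih (by omega)
        have h1 : V.shapeAt (2 * i + 1) = ⊥ ∨ V.shapeAt (2 * i + 1) = oneSquare := by
          rcases V.shapeAt_odd hi with h | h
          · rwa [h]
          · rcases h0 with h0 | h0 <;> rw [h0] at h
            · exact absurd h (not_addsSquare_bot _)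
            · exact Or.inl h.eq_bot
        change V.shapeAt (2 * i + 2) = ⊥ ∨ V.shapeAt (2 * i + 2) = oneSquare
        rcases V.shapeAt_even hi with h | h
        · rwa [h]
        · exact Or.inr (h.eq_oneSquare h1 (hc _))
    intro m
    rw [← V.shapeAt_of_lt m.2]
    rcases Nat.even_or_odd' m with ⟨i, h | h⟩ <;> rw [h]
    · exact key i (by omega)
    · rcases V.shapeAt_odd (i := i) (by omega) with h' | h'
      · rw [h']; exact key i (by omega)
      · rcases key i (by omega) with h0 | h0 <;> rw [h0] at h'
        · exact absurd h' (not_addsSquare_bot _)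
        · exact Or.inl h'.eq_bot
  · intro h
    refine VacillatingTableau.ext (funext fun m => ?_)
    change (V.shape m).transpose = V.shape m
    rcases h m with h | h <;> rw [h]
    · exact YoungDiagram.transpose_bot'
    · exact oneSquare_transpose

/-! ### Flat tableaux -/

section
variable {n : ℕ}

/-- A shape of odd index is contained in both its neighbours. For flat tableaux this is the only
constraint besides the empty ends, as `exists_flatTableau` shows. -/
theorem ne_bot_of_odd_ne_bot (V : VacillatingTableau n ⊥) {i : ℕ} (hi : i < n)
    (h : V.shapeAt (2 * i + 1) ≠ ⊥) : V.shapeAt (2 * i) ≠ ⊥ ∧ V.shapeAt (2 * i + 2) ≠ ⊥ := by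
  refine ⟨fun h0 => ?_, fun h0 => ?_⟩
  · rcases V.shapeAt_odd hi with h1 | h1
    · exact h (h1.trans h0)
    · rw [h0] at h1; exact not_addsSquare_bot _ h1
  · rcases V.shapeAt_even hi with h1 | h1
    · exact h (h1.symm.trans h0)
    · rw [h0] at h1; exact not_addsSquare_bot _ h1

theorem flatTableaux_ext {V W : VacillatingTableau n ⊥} (hV : V ∈ flatTableaux n)
    (hW : W ∈ flatTableaux n)
    (h : ∀ m < 2 * n + 1, V.shapeAt m = ⊥ ↔ W.shapeAt m = ⊥) : V = W := by
  refine VacillatingTableau.ext (funext fun m => ?_)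
  have := h m m.2
  rw [V.shapeAt_of_lt m.2, W.shapeAt_of_lt m.2] at this
  rcases hV m with h1 | h1 <;> rcases hW m with h2 | h2
  · rw [h1, h2]
  · exact absurd (h2.symm.trans (this.1 h1)) oneSquare_ne_bot
  · exact absurd (h1.symm.trans (this.2 h2)) oneSquare_ne_bot
  · rw [h1, h2]

open Classical in
theorem exists_flatTableau {A : ℕ → Prop} (h0 : ¬A 0) (hn : ¬A (2 * n))
    (h : ∀ i < n, A (2 * i + 1) → A (2 * i) ∧ A (2 * i + 2)) :
    ∃ V ∈ flatTableaux n, ∀ m < 2 * n + 1, V.shapeAt m ≠ ⊥ ↔ A m := by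
  refine ⟨⟨fun m => if A m then oneSquare else ⊥, if_neg h0, if_neg hn, fun i => ?_, fun i => ?_⟩,
    fun m => ?_, fun m hm => ?_⟩
  · by_cases h1 : A (2 * i + 1)
    · simp [h1, (h i i.2 h1).1]
    · by_cases h2 : A (2 * i)
      · simp [h1, h2, addsSquare_bot_oneSquare]
      · simp [h1, h2]
  · by_cases h1 : A (2 * i + 1)
    · simp [h1, (h i i.2 h1).2]
    · by_cases h2 : A (2 * i + 2)
      · simp [h1, h2, addsSquare_bot_oneSquare]
      · simp [h1, h2]
  · by_cases h1 : A m <;> simp [h1]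
  · rw [VacillatingTableau.shapeAt_of_lt _ hm]
    by_cases h1 : A m <;> simp [h1, oneSquare_ne_bot]

open Classical in
theorem toMotzkin_height (V : flatTableaux n) (i : ℕ) (hi : i < n + 1) :
    (toMotzkin V).height ⟨i, hi⟩ = if V.1.shapeAt (2 * i) = ⊥ then 0 else 1 := by
  rw [V.1.shapeAt_of_lt (by omega)]
  rfl

open Classical in
theorem toMotzkin_label (V : flatTableaux n) (i : ℕ) (hi : i < n) :
    (toMotzkin V).label ⟨i, hi⟩ =
      if V.1.shapeAt (2 * i) ≠ ⊥ ∧ V.1.shapeAt (2 * i + 2) ≠ ⊥ then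
        some (if V.1.shapeAt (2 * i + 1) = ⊥ then 1 else 0) else none := by
  rw [V.1.shapeAt_of_lt (by omega), V.1.shapeAt_of_lt (by omega), V.1.shapeAt_of_lt (by omega)]
  rfl

theorem toMotzkin_injective : Function.Injective (toMotzkin (n := n)) := by
  classical
  intro V W h
  have heven : ∀ i < n + 1, V.1.shapeAt (2 * i) = ⊥ ↔ W.1.shapeAt (2 * i) = ⊥ := by
    intro i hi
    have e := toMotzkin_height V i hi
    rw [h, toMotzkin_height W i hi] at e
    split_ifs at e <;> simp_all
  refine Subtype.ext (flatTableaux_ext V.2 W.2 fun m hm => ?_)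
  rcases Nat.even_or_odd' m with ⟨i, rfl | rfl⟩
  · exact heven i (by omega)
  · have e := toMotzkin_label V i (by omega)
    rw [h, toMotzkin_label W i (by omega)] at e
    have h1 := heven i (by omega)
    have h2 : V.1.shapeAt (2 * i + 2) = ⊥ ↔ W.1.shapeAt (2 * i + 2) = ⊥ :=
      heven (i + 1) (by omega)
    have h3 := ne_bot_of_odd_ne_bot V.1 (i := i) (by omega)
    have h4 := ne_bot_of_odd_ne_bot W.1 (i := i) (by omega)
    by_cases hb : V.1.shapeAt (2 * i) ≠ ⊥ ∧ V.1.shapeAt (2 * i + 2) ≠ ⊥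
    · have hb' : W.1.shapeAt (2 * i) ≠ ⊥ ∧ W.1.shapeAt (2 * i + 2) ≠ ⊥ := by
        rwa [Ne, Ne, ← h1, ← h2]
      rw [if_pos hb, if_pos hb'] at e
      split_ifs at e <;> simp_all
    · have hb' : ¬(W.1.shapeAt (2 * i) ≠ ⊥ ∧ W.1.shapeAt (2 * i + 2) ≠ ⊥) := by
        rwa [Ne, Ne, ← h1, ← h2]
      exact iff_of_true (by_contra fun h => hb (h3 h)) (by_contra fun h => hb' (h4 h))

theorem toMotzkin_surjective : Function.Surjective (toMotzkin (n := n)) := by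
  classical
  intro M
  -- The indices where the shape is to be (1): at even indices read off the height, at odd indices
  -- the label 0.
  let A : ℕ → Prop := fun m =>
    if m % 2 = 0 then ∃ h : m / 2 < n + 1, M.height ⟨m / 2, h⟩ = 1
    else ∃ h : m / 2 < n, M.label ⟨m / 2, h⟩ = some 0
  have hA0 : ∀ i (hi : i < n + 1), A (2 * i) ↔ M.height ⟨i, hi⟩ = 1 := by
    intro i hi
    have e : 2 * i / 2 = i := by omega
    simp only [A, if_pos (show 2 * i % 2 = 0 by omega), e]
    exact ⟨fun ⟨_, h⟩ => h, fun h => ⟨hi, h⟩⟩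
  have hA1 : ∀ i (hi : i < n), A (2 * i + 1) ↔ M.label ⟨i, hi⟩ = some 0 := by
    intro i hi
    have e : (2 * i + 1) / 2 = i := by omega
    simp only [A, if_neg (show ¬(2 * i + 1) % 2 = 0 by omega), e]
    exact ⟨fun ⟨_, h⟩ => h, fun h => ⟨hi, h⟩⟩
  obtain ⟨V, hV, hVA⟩ := exists_flatTableau (n := n) (A := A)
    (by
      have h := M.height_zero
      rw [show 0 = 2 * 0 by omega, hA0 0 (by omega)]
      intro h'
      exact absurd (h.symm.trans h') (by omega))
    (by
      have h := M.height_last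
      rw [hA0 n (by omega)]
      intro h'
      exact absurd (h.symm.trans h') (by omega))
    (by
      intro i hi h
      rw [hA1 i hi] at h
      obtain ⟨h1, h2⟩ := (M.label_isSome ⟨i, hi⟩).1 (by rw [h]; rfl)
      exact ⟨(hA0 i (by omega)).2 h1, (hA0 (i + 1) (by omega)).2 h2⟩)
  have hh : ∀ i (hi : i < n + 1), V.shapeAt (2 * i) ≠ ⊥ ↔ M.height ⟨i, hi⟩ = 1 := fun i hi =>
    (hVA _ (by omega)).trans (hA0 i hi)
  refine ⟨⟨V, hV⟩, ?_⟩
  apply ColouredMotzkinPath.ext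
  · funext ⟨i, hi⟩
    rw [toMotzkin_height]
    have h1 := hh i hi
    have h2 := M.height_le ⟨i, hi⟩
    split_ifs with h
    · have : ¬M.height ⟨i, hi⟩ = 1 := fun h' => h1.2 h' h
      omega
    · exact (h1.1 h).symm
  · funext ⟨i, hi⟩
    rw [toMotzkin_label]
    have h1 := hh i (by omega)
    have h2 : V.shapeAt (2 * i + 2) ≠ ⊥ ↔ _ := hh (i + 1) (by omega)
    have h3 := (hVA (2 * i + 1) (by omega)).trans (hA1 i hi)
    have h4 := M.label_isSome ⟨i, hi⟩
    change _ ↔ M.height ⟨i, by omega⟩ = 1 ∧ M.height ⟨i + 1, by omega⟩ = 1 at h4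
    rw [← h1, ← h2] at h4
    split_ifs with h5 h6
    · have h7 := h4.2 h5
      rw [Option.isSome_iff_exists] at h7
      obtain ⟨a, ha⟩ := h7
      have : a ≠ 0 := fun h => h3.2 (by rw [ha, h]) h6
      rw [ha]
      congr 1
      omega
    · exact (h3.1 h6).symm
    · rw [← h4] at h5
      exact (Option.not_isSome_iff_eq_none.1 h5).symm

end

/-! ### Counting -/

/-- The possible sets of indices `m ≤ 2 n` with `λᵐ = (1)` in sequences `λ⁰, …, λ²ⁿ` of partitions
`∅` and `(1)` which start with `∅` and vacillate, where `b` says whether `λ²ⁿ = (1)`. -/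
def flatSupports (n : ℕ) (b : Prop) : Set (Finset ℕ) :=
  {s | 0 ∉ s ∧ (2 * n ∈ s ↔ b) ∧ (∀ m ∈ s, m ≤ 2 * n) ∧
    ∀ i < n, 2 * i + 1 ∈ s → 2 * i ∈ s ∧ 2 * i + 2 ∈ s}

/-- The numbers of elements of `flatSupports n False` and `flatSupports n True`. -/
def flatCount : ℕ → ℕ × ℕ
  | 0 => (1, 0)
  | n + 1 => ((flatCount n).1 + (flatCount n).2, (flatCount n).1 + 2 * (flatCount n).2)

theorem flatSupports_succ_false (n : ℕ) :
    flatSupports (n + 1) False = flatSupports n False ∪ flatSupports n True := by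
  ext s
  simp only [flatSupports, Set.mem_union, Set.mem_ofPred_eq]
  constructor
  · rintro ⟨h1, h2, h3, h4⟩
    have h2' : 2 * n + 2 ∉ s := fun h => h2.1 h
    have h5 : 2 * n + 1 ∉ s := fun h => h2' (h4 n (by omega) h).2
    have h6 : ∀ m ∈ s, m ≤ 2 * n := fun m hm => by
      have := h3 m hm
      have : m ≠ 2 * n + 1 := fun e => h5 (e ▸ hm)
      have : m ≠ 2 * n + 2 := fun e => h2' (e ▸ hm)
      omega
    have h7 : ∀ i < n, 2 * i + 1 ∈ s → 2 * i ∈ s ∧ 2 * i + 2 ∈ s := fun i hi => h4 i (by omega)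
    by_cases h : 2 * n ∈ s
    · exact Or.inr ⟨h1, iff_true_intro h, h6, h7⟩
    · exact Or.inl ⟨h1, iff_false_intro h, h6, h7⟩
  · have key : ∀ s : Finset ℕ, (∀ m ∈ s, m ≤ 2 * n) →
        (∀ i < n, 2 * i + 1 ∈ s → 2 * i ∈ s ∧ 2 * i + 2 ∈ s) → (2 * (n + 1) ∈ s ↔ False) ∧
        (∀ m ∈ s, m ≤ 2 * (n + 1)) ∧
        ∀ i < n + 1, 2 * i + 1 ∈ s → 2 * i ∈ s ∧ 2 * i + 2 ∈ s := by
      intro s h3 h4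
      refine ⟨iff_false_intro fun h => by have := h3 _ h; omega,
        fun m hm => by have := h3 _ hm; omega, fun i hi h => h4 i ?_ h⟩
      have := h3 _ h
      omega
    rintro (⟨h1, -, h3, h4⟩ | ⟨h1, -, h3, h4⟩) <;> exact ⟨h1, key s h3 h4⟩

/-- The three pieces are the ways to end at height 1: an up step, and a level step with label 1 or
with label 0. -/
theorem flatSupports_succ_true (n : ℕ) :
    flatSupports (n + 1) True = insert (2 * n + 2) '' flatSupports n False ∪
      (insert (2 * n + 2) '' flatSupports n True ∪
        (fun s => insert (2 * n + 1) (insert (2 * n + 2) s)) '' flatSupports n True) := by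
  ext s
  constructor
  · rintro ⟨h1, h2, h3, h4⟩
    have h2' : 2 * n + 2 ∈ s := h2.2 trivial
    have h5 : ∀ b, (2 * n ∈ s ↔ b) →
        (s.erase (2 * n + 2)).erase (2 * n + 1) ∈ flatSupports n b := by
      intro b hb
      refine ⟨by simp [h1], ?_, fun m hm => ?_, fun i hi => ?_⟩
      · simpa using hb
      · simp only [Finset.mem_erase] at hm
        have := h3 m hm.2.2
        omega
      · have := h4 i (by omega)
        simp only [Finset.mem_erase]
        intro h
        obtain ⟨h6, h7⟩ := this h.2.2
        exact ⟨⟨by omega, by omega, h6⟩, by omega, by omega, h7⟩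
    by_cases h : 2 * n + 1 ∈ s
    · refine Or.inr (Or.inr ⟨_, h5 True (iff_true_intro (h4 n (by omega) h).1), ?_⟩)
      ext m
      simp only [Finset.mem_insert, Finset.mem_erase]
      by_cases e1 : m = 2 * n + 1
      · simp [e1, h]
      · by_cases e2 : m = 2 * n + 2
        · simp [e2, h2']
        · simp [e1, e2]
    · have e : insert (2 * n + 2) ((s.erase (2 * n + 2)).erase (2 * n + 1)) = s := by
        ext m
        simp only [Finset.mem_insert, Finset.mem_erase]
        by_cases e1 : m = 2 * n + 1
        · simp [e1, h]
        · by_cases e2 : m = 2 * n + 2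
          · simp [e2, h2']
          · simp [e1, e2]
      by_cases h0 : 2 * n ∈ s
      · exact Or.inr (Or.inl ⟨_, h5 True (iff_true_intro h0), e⟩)
      · exact Or.inl ⟨_, h5 False (iff_false_intro h0), e⟩
  · have key : ∀ b, ∀ s ∈ flatSupports n b, insert (2 * n + 2) s ∈ flatSupports (n + 1) True := by
      rintro b s ⟨h1, h2, h3, h4⟩
      refine ⟨by simp [h1], by simp [Nat.mul_add], fun m hm => ?_, fun i hi h => ?_⟩
      · rcases Finset.mem_insert.1 hm with rfl | hm
        · omega
        · have := h3 m hm; omega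
      · have hs : 2 * i + 1 ∈ s := (Finset.mem_insert.1 h).resolve_left (by omega)
        have := h3 _ hs
        obtain ⟨h5, h6⟩ := h4 i (by omega) hs
        exact ⟨Finset.mem_insert_of_mem h5, Finset.mem_insert_of_mem h6⟩
    rintro (⟨s, hs, rfl⟩ | ⟨s, hs, rfl⟩ | ⟨s, hs, rfl⟩)
    · exact key _ s hs
    · exact key _ s hs
    · obtain ⟨h1, h2, h3, h4⟩ := key _ s hs
      refine ⟨by simpa using h1, by simp [Nat.mul_add], fun m hm => ?_, fun i hi h => ?_⟩
      · rcases Finset.mem_insert.1 hm with rfl | hm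
        · omega
        · exact h3 m hm
      · rcases Finset.mem_insert.1 h with e | h
        · obtain rfl : i = n := by omega
          have := hs.2.1.2 trivial
          simp [this]
        · obtain ⟨h5, h6⟩ := h4 i hi h
          exact ⟨Finset.mem_insert_of_mem h5, Finset.mem_insert_of_mem h6⟩

theorem encard_flatSupports (n : ℕ) : (flatSupports n False).encard = (flatCount n).1 ∧
    (flatSupports n True).encard = (flatCount n).2 := by
  induction n with
  | zero =>
    constructor
    · have : flatSupports 0 False = {∅} := by
        ext s
        simp only [flatSupports, Set.mem_ofPred_eq, Set.mem_singleton_iff]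
        constructor
        · rintro ⟨h1, -, h3, -⟩
          refine Finset.eq_empty_of_forall_notMem fun m hm => h1 ?_
          have := h3 m hm
          obtain rfl : m = 0 := by omega
          exact hm
        · rintro rfl; simp
      rw [this]; simp [flatCount]
    · have : flatSupports 0 True = ∅ := by
        ext s
        simp only [flatSupports, Set.mem_ofPred_eq, Set.mem_empty_iff_false, iff_false]
        rintro ⟨h1, h2, -⟩
        exact h1 (h2.2 trivial)
      rw [this]; simp [flatCount]
  | succ n ih =>
    obtain ⟨ha, hb⟩ := ih
    have hdisj : Disjoint (flatSupports n False) (flatSupports n True) :=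
      Set.disjoint_left.2 fun s h1 h2 => h1.2.1.1 (h2.2.1.2 trivial)
    have hn : ∀ b, ∀ s ∈ flatSupports n b, 2 * n + 1 ∉ s ∧ 2 * n + 2 ∉ s := fun b s hs =>
      ⟨fun h => by have := hs.2.2.1 _ h; omega, fun h => by have := hs.2.2.1 _ h; omega⟩
    have inj : ∀ b c, ∀ s ∈ flatSupports n b, ∀ t ∈ flatSupports n c,
        insert (2 * n + 2) s = insert (2 * n + 2) t → s = t := fun b c s hs t ht h => by
      rw [← Finset.erase_insert (hn b s hs).2, h, Finset.erase_insert (hn c t ht).2]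
    constructor
    · rw [flatSupports_succ_false, Set.encard_union_eq hdisj, ha, hb]
      simp [flatCount]
    · have hd1 : ∀ b, ∀ s ∈ flatSupports n b, 2 * n + 1 ∉ insert (2 * n + 2) s :=
        fun b s hs => by simpa using (hn b s hs).1
      rw [flatSupports_succ_true, Set.encard_union_eq, Set.encard_union_eq,
        Set.InjOn.encard_image, Set.InjOn.encard_image, Set.InjOn.encard_image, ha, hb]
      · simp only [flatCount]
        push_cast
        ring
      · intro s hs t ht h
        refine inj _ _ s hs t ht ?_
        have h : insert (2 * n + 1) (insert (2 * n + 2) s) =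
          insert (2 * n + 1) (insert (2 * n + 2) t) := h
        rw [← Finset.erase_insert (hd1 _ s hs), h, Finset.erase_insert (hd1 _ t ht)]
      · exact fun s hs t ht h => inj _ _ s hs t ht h
      · exact fun s hs t ht h => inj _ _ s hs t ht h
      · refine Set.disjoint_left.2 ?_
        rintro _ ⟨s, hs, rfl⟩ ⟨t, ht, h⟩
        refine hd1 _ s hs ?_
        rw [← h]
        simp
      · refine Set.disjoint_left.2 ?_
        rintro _ ⟨s, hs, rfl⟩ (⟨t, ht, h⟩ | ⟨t, ht, h⟩)
        · rw [inj _ _ t ht s hs h] at ht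
          exact Set.disjoint_left.1 hdisj hs ht
        · refine hd1 _ s hs ?_
          rw [← h]
          simp

open Classical in
theorem ncard_flatTableaux (n : ℕ) : (flatTableaux n).ncard = (flatCount n).1 := by
  let f : VacillatingTableau n ⊥ → Finset ℕ := fun V =>
    (Finset.range (2 * n + 1)).filter fun m => V.shapeAt m ≠ ⊥
  have hf : ∀ V m, m ∈ f V ↔ m < 2 * n + 1 ∧ V.shapeAt m ≠ ⊥ := fun V m => by simp [f]
  have hinj : Set.InjOn f (flatTableaux n) := by
    intro V hV W hW h
    refine flatTableaux_ext hV hW fun m hm => ?_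
    have h1 := hf V m
    rw [h, hf W m] at h1
    simpa [hm, not_iff_not] using h1.symm
  have himg : f '' flatTableaux n = flatSupports n False := by
    ext s
    constructor
    · rintro ⟨V, hV, rfl⟩
      refine ⟨?_, ?_, fun m hm => ?_, fun i hi h => ?_⟩
      · rw [hf, V.shapeAt_zero]; simp
      · rw [hf, V.shapeAt_last]; simp
      · exact Nat.lt_succ_iff.1 ((hf V m).1 hm).1
      · obtain ⟨h1, h2⟩ := ne_bot_of_odd_ne_bot V hi ((hf V _).1 h).2
        exact ⟨(hf V _).2 ⟨by omega, h1⟩, (hf V _).2 ⟨by omega, h2⟩⟩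
    · rintro ⟨h1, h2, h3, h4⟩
      obtain ⟨V, hV, hVs⟩ := exists_flatTableau (n := n) (A := fun m => m ∈ s) h1 h2.1 h4
      refine ⟨V, hV, Finset.ext fun m => ?_⟩
      rw [hf]
      constructor
      · rintro ⟨h5, h6⟩
        exact (hVs m h5).1 h6
      · intro h
        have h5 : m < 2 * n + 1 := Nat.lt_succ_iff.2 (h3 m h)
        exact ⟨h5, (hVs m h5).2 h⟩
  rw [← hinj.ncard_image, himg, Set.ncard, (encard_flatSupports n).1, ENat.toNat_natCast]

/-- The second identity carries the second-order recursion through an induction of one step. -/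
theorem flatCount_eq_oddFib (n : ℕ) : ((flatCount n).1 : ℤ) = oddFib n ∧
    ((flatCount n).1 : ℤ) + (flatCount n).2 = oddFib (n + 1) := by
  induction n with
  | zero => simp [flatCount, oddFib]
  | succ n ih =>
    obtain ⟨h1, h2⟩ := ih
    refine ⟨by rw [← h2, flatCount]; push_cast; ring, ?_⟩
    rw [oddFib, ← h1, ← h2, flatCount]
    push_cast
    ring

theorem flatCount_succ_eq_fib (n : ℕ) :
    flatCount (n + 1) = (Nat.fib (2 * n + 1), Nat.fib (2 * n + 2)) := by
  induction n with
  | zero => simp [flatCount]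
  | succ n ih =>
    rw [flatCount, ih, Prod.mk.injEq]
    have h1 : Nat.fib (2 * (n + 1) + 1) = Nat.fib (2 * n + 1) + Nat.fib (2 * n + 2) :=
      Nat.fib_add_two
    have h2 : Nat.fib (2 * (n + 1) + 2) = Nat.fib (2 * n + 2) + Nat.fib (2 * (n + 1) + 1) :=
      Nat.fib_add_two
    omega

/-! ### The main theorem -/

theorem conjugateTableau_involutive (n : ℕ) : Function.Involutive (conjugateTableau (n := n)) :=
  fun V => VacillatingTableau.ext (funext fun m => YoungDiagram.transpose_transpose (V.shape m))

theorem mainTheorem10 (n : ℕ) :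
    (∃ φ : SetPartition n ≃ VacillatingTableau n ⊥,
      IsCDDSYMap φ ∧
      Function.Involutive (φ.symm ∘ conjugateTableau ∘ φ) ∧
      ((Function.fixedPoints (φ.symm ∘ conjugateTableau ∘ φ)).ncard : ℤ) = oddFib n ∧
      (1 ≤ n →
        (Function.fixedPoints (φ.symm ∘ conjugateTableau ∘ φ)).ncard = Nat.fib (2 * n - 1))) ∧
    Function.fixedPoints (conjugateTableau (n := n)) = flatTableaux n ∧
    Function.Bijective (toMotzkin (n := n)) := by
  refine ⟨?_, fixedPoints_conjugateTableau n, toMotzkin_injective, toMotzkin_surjective⟩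
  let φ : SetPartition n ≃ VacillatingTableau n ⊥ :=
    Equiv.ofBijective cddsyMap ⟨cddsyMap_injective n, cddsyMap_surjective n⟩
  have hfix : (Function.fixedPoints (φ.symm ∘ conjugateTableau ∘ φ)).ncard = (flatCount n).1 := by
    have himg : φ '' Function.fixedPoints (φ.symm ∘ conjugateTableau ∘ φ) = flatTableaux n := by
      rw [← fixedPoints_conjugateTableau]
      ext V
      rw [Equiv.image_eq_preimage_symm, Set.mem_preimage, Function.mem_fixedPoints,
        Function.mem_fixedPoints, Function.IsFixedPt, Function.IsFixedPt]
      simp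
    rw [← ncard_flatTableaux, ← himg, Set.ncard_image_of_injective _ φ.injective]
  refine ⟨φ, isCDDSYMap_cddsyMap, fun P => ?_, ?_, fun hn => ?_⟩
  · simp [conjugateTableau_involutive n _]
  · rw [hfix, (flatCount_eq_oddFib n).1]
  · obtain ⟨m, rfl⟩ : ∃ m, n = m + 1 := ⟨n - 1, by omega⟩
    rw [hfix, flatCount_succ_eq_fib, show 2 * (m + 1) - 1 = 2 * m + 1 by omega]
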